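/- **Theorem.** Let $M$ be a smooth manifold with Riemannian metric $g$ and Levi-Civita connection $\nabla$, and let $(\phi,\eta,\xi)$ (a smooth $(1,1)$-tensor field, a smooth $1$-form and a smooth vector field) make $M$ a P-Sasakian manifold, i.e. $$\phi^2=I-\eta\otimes\xi,\quad \eta(\xi)=1,\quad \phi\xi=0,\quad \eta\circ\phi=0,\qquad g(X,Y)=g(\phi X,\phi Y)+\eta(X)\eta(Y),$$ $$(\nabla_X\phi)(Y)=-g(X,Y)\xi-\eta(Y)X+2\eta(X)\eta(Y)\xi$$ for all smooth vector fields $X,Y$ on $M$. Let $p,q$ be positive integers and $\sigma_{p,q}=\frac{p+\sqrt{p^2+4q}}{2}$. On the tangent bundle $TM$ let $$J=\frac p2 I-\frac{2\sigma_{p,q}-p}{2}\left(\phi^c+\eta^v\otimes\xi^v+\eta^c\otimes\xi^c\right),$$ where $v$ and $c$ denote the vertical and the complete lift; in the chart $(x^i,y^i)$ of $TM$ induced by a chart $(x^i)$ of $M$, $$\xi^v=\xi^i\frac{\partial}{\partial y^i},\quad \xi^c=\xi^i\frac{\partial}{\partial x^i}+y^j\frac{\partial \xi^i}{\partial x^j}\frac{\partial}{\partial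 y^i},\quad \eta^v=\eta_i\,dx^i,\quad \eta^c=y^j\frac{\partial\eta_i}{\partial x^j}dx^i+\eta_i\,dy^i,$$ $$\phi^c\frac{\partial}{\partial x^k}=\phi^i_k\frac{\partial}{\partial x^i}+y^j\frac{\partial\phi^i_k}{\partial x^j}\frac{\partial}{\partial y^i},\qquad \phi^c\frac{\partial}{\partial y^k}=\phi^i_k\frac{\partial}{\partial y^i}.$$ Then $J$ is a metallic structure on $TM$, that is, a smooth $(1,1)$-tensor field with $J^2=pJ+qI$, and $J$ is integrable: its Nijenhuis tensor $$N_J(\tilde X,\tilde Y)=[J\tilde X,J\tilde Y]-J[J\tilde X,\tilde Y]-J[\tilde X,J\tilde Y]+J^2[\tilde X,\tilde Y]$$ vanishes for all smooth vector fields $\tilde X,\tilde Y$ on $TM$. -/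

import Mathlib

open Bundle VectorField
open scoped Manifold ContDiff

noncomputable section

/-! ### Vector fields, 1-forms and (1,1)-tensor fields on a smooth manifold -/

section Tensors

variable {E : Type*} [NormedAddCommGroup E] [NormedSpace ℝ E]
  {H : Type*} [TopologicalSpace H] (I : ModelWithCorners ℝ E H)
  {M : Type*} [TopologicalSpace M] [ChartedSpace H M]

/-- A smooth vector field. -/
def IsSmoothVectorField [IsManifold I 1 M] (X : ∀ x : M, TangentSpace I x) : Prop :=
  ContMDiff I I.tangent ∞ (fun x => (⟨x, X x⟩ : TangentBundle I M))

/-- A smooth 1-form, as a smooth section of the cotangent bundle. -/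
def IsSmoothOneForm [IsManifold I 1 M] (α : ∀ x : M, TangentSpace I x →L[ℝ] ℝ) : Prop :=
  ContMDiff I (I.prod 𝓘(ℝ, E →L[ℝ] ℝ)) ∞
    (fun x => TotalSpace.mk' (E →L[ℝ] ℝ)
      (E := fun x : M => TangentSpace I x →L[ℝ] Bundle.Trivial M ℝ x) x (α x))

/-- A smooth tensor field of type (1,1), as a smooth section of the endomorphism bundle of the
tangent bundle. -/
def IsSmoothEndoField [IsManifold I 1 M]
    (F : ∀ x : M, TangentSpace I x →L[ℝ] TangentSpace I x) : Prop :=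
  ContMDiff I (I.prod 𝓘(ℝ, E →L[ℝ] E)) ∞
    (fun x => TotalSpace.mk' (E →L[ℝ] E)
      (E := fun x : M => TangentSpace I x →L[ℝ] TangentSpace I x) x (F x))

/-- The Nijenhuis tensor `N_J(X, Y) = [JX, JY] - J[JX, Y] - J[X, JY] + J²[X, Y]`. -/
def nijenhuis (J : ∀ x : M, TangentSpace I x →L[ℝ] TangentSpace I x)
    (X Y : ∀ x : M, TangentSpace I x) (x : M) : TangentSpace I x :=
  mlieBracket I (fun z => J z (X z)) (fun z => J z (Y z)) x
    - J x (mlieBracket I (fun z => J z (X z)) Y x)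
    - J x (mlieBracket I X (fun z => J z (Y z)) x)
    + J x (J x (mlieBracket I X Y x))

/-- A (1,1)-tensor field `J` is integrable if its Nijenhuis tensor vanishes. -/
def IsIntegrableEndoField [IsManifold I 1 M]
    (J : ∀ x : M, TangentSpace I x →L[ℝ] TangentSpace I x) : Prop :=
  ∀ X Y : ∀ x : M, TangentSpace I x, IsSmoothVectorField I X → IsSmoothVectorField I Y →
    ∀ x : M, nijenhuis I J X Y x = 0

/-- A `(p, q)`-metallic structure: a smooth (1,1)-tensor field with `J² = p J + q I`, where
`p` and `q` are positive integers. -/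
structure IsMetallicStructure [IsManifold I 1 M] (p q : ℕ)
    (J : ∀ x : M, TangentSpace I x →L[ℝ] TangentSpace I x) : Prop where
  p_pos : 0 < p
  q_pos : 0 < q
  smooth : IsSmoothEndoField I J
  sq_eq : ∀ (x : M) (v : TangentSpace I x), J x (J x v) = (p : ℝ) • J x v + (q : ℝ) • v

end Tensors

/-- The member `σ_{p,q} = (p + √(p² + 4q)) / 2` of the metallic means family. -/
def metallicMean (p q : ℕ) : ℝ := ((p : ℝ) + Real.sqrt ((p : ℝ) ^ 2 + 4 * (q : ℝ))) / 2

/-! ### P-Sasakian manifolds -/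

section PSasakian

variable {E : Type*} [NormedAddCommGroup E] [NormedSpace ℝ E]
  {H : Type*} [TopologicalSpace H] (I : ModelWithCorners ℝ E H)
  {M : Type*} [TopologicalSpace M] [ChartedSpace H M]

/-- An almost paracontact structure `(φ, η, ξ)`. -/
structure IsAlmostParacontact [IsManifold I 1 M]
    (φ : ∀ x : M, TangentSpace I x →L[ℝ] TangentSpace I x)
    (η : ∀ x : M, TangentSpace I x →L[ℝ] ℝ) (ξ : ∀ x : M, TangentSpace I x) : Prop where
  smooth_phi : IsSmoothEndoField I φ
  smooth_eta : IsSmoothOneForm I η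
  smooth_xi : IsSmoothVectorField I ξ
  phi_phi : ∀ (x : M) (v : TangentSpace I x), φ x (φ x v) = v - η x v • ξ x
  eta_xi : ∀ x : M, η x (ξ x) = 1
  phi_xi : ∀ x : M, φ x (ξ x) = 0
  eta_phi : ∀ (x : M) (v : TangentSpace I x), η x (φ x v) = 0

/-- `∇` is the Levi-Civita connection of the Riemannian metric: it is compatible with the metric
and torsion-free. -/
def IsLeviCivita [FiniteDimensional ℝ E] [IsManifold I ∞ M]
    [RiemannianBundle (fun x : M => TangentSpace I x)]
    [IsContMDiffRiemannianBundle I ∞ E (fun x : M => TangentSpace I x)]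
    (nabla : CovariantDerivative I E (fun x : M => TangentSpace I x)) : Prop :=
  haveI : CompleteSpace E := FiniteDimensional.complete ℝ E
  nabla.IsMetricCompatible ∧ nabla.torsion = 0

/-- The almost paracontact Riemannian manifold `M`, with structure `(φ, η, ξ)`, with the ambient
Riemannian metric and with Levi-Civita connection `∇`, is P-Sasakian:
`(∇_X φ) Y = - g(X, Y) ξ - η(Y) X + 2 η(X) η(Y) ξ`.
In Mathlib's argument order, `nabla Y x (X x)` is the value of `∇_X Y` at `x`. -/
structure IsPSasakian [FiniteDimensional ℝ E] [IsManifold I ∞ M]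
    [RiemannianBundle (fun x : M => TangentSpace I x)]
    [IsContMDiffRiemannianBundle I ∞ E (fun x : M => TangentSpace I x)]
    (nabla : CovariantDerivative I E (fun x : M => TangentSpace I x))
    (φ : ∀ x : M, TangentSpace I x →L[ℝ] TangentSpace I x)
    (η : ∀ x : M, TangentSpace I x →L[ℝ] ℝ) (ξ : ∀ x : M, TangentSpace I x) : Prop where
  paracontact : IsAlmostParacontact I φ η ξ
  metric_compatible : ∀ (x : M) (v w : TangentSpace I x),
    inner ℝ v w = inner ℝ (φ x v) (φ x w) + η x v * η x w
  leviCivita : IsLeviCivita I nabla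
  nabla_phi : ∀ X Y : ∀ x : M, TangentSpace I x,
    IsSmoothVectorField I X → IsSmoothVectorField I Y → ∀ x : M,
      nabla (fun z => φ z (Y z)) x (X x) - φ x (nabla Y x (X x))
        = -(inner ℝ (X x) (Y x) : ℝ) • ξ x - η x (Y x) • X x
          + (2 * η x (X x) * η x (Y x)) • ξ x

end PSasakian

/-! ### Vertical and complete lifts to the tangent bundle

For `v = (x, y)` in `TM`, the fibre `TangentSpace I.tangent v` of `T(TM)` is by construction the
space `E × E` of coordinate vectors with respect to the chart of `TM` induced by the preferred
chart of `M` at `x`: the pair `(a, b)` stands for `aⁱ ∂/∂xⁱ + bⁱ ∂/∂yⁱ`, and `a = π_* (a, b)`.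
In the same chart, `TangentSpace I x` is `E`. The lifts below are the usual coordinate
expressions in the induced chart at `v`. -/

section Lifts

variable {E : Type*} [NormedAddCommGroup E] [NormedSpace ℝ E]
  {H : Type*} [TopologicalSpace H] (I : ModelWithCorners ℝ E H)
  {M : Type*} [TopologicalSpace M] [ChartedSpace H M] [IsManifold I 1 M]

/-- The components of a vector field in the preferred chart at `x₀`. -/
def vectorFieldRep (X : ∀ x : M, TangentSpace I x) (x₀ x : M) : E :=
  (trivializationAt E (TangentSpace I) x₀).continuousLinearMapAt ℝ x (X x)

/-- The components of a 1-form in the preferred chart at `x₀`. -/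
def oneFormRep (α : ∀ x : M, TangentSpace I x →L[ℝ] ℝ) (x₀ x : M) : E →L[ℝ] ℝ :=
  (α x).comp ((trivializationAt E (TangentSpace I) x₀).symmL ℝ x)

/-- The components of a (1,1)-tensor field in the preferred chart at `x₀`. -/
def endoFieldRep (F : ∀ x : M, TangentSpace I x →L[ℝ] TangentSpace I x) (x₀ x : M) : E →L[ℝ] E :=
  ((trivializationAt E (TangentSpace I) x₀).continuousLinearMapAt ℝ x).comp
    ((F x).comp ((trivializationAt E (TangentSpace I) x₀).symmL ℝ x))

/-- The vertical lift `f^v = f ∘ π` of a function. -/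
def funVerticalLift (f : M → ℝ) (v : TangentBundle I M) : ℝ := f v.proj

/-- The complete lift `f^c (x, y) = df_x(y)` of a function. -/
def funCompleteLift (f : M → ℝ) (v : TangentBundle I M) : ℝ := mvfderiv I f v.proj v.snd

/-- The vertical lift of a vector field: `X^v = Xⁱ ∂/∂yⁱ`. -/
def vectorVerticalLift (X : ∀ x : M, TangentSpace I x) (v : TangentBundle I M) :
    TangentSpace I.tangent v :=
  ((0 : E), (X v.proj : E))

/-- The complete lift of a vector field: `X^c = Xⁱ ∂/∂xⁱ + yʲ (∂Xⁱ/∂xʲ) ∂/∂yⁱ`. -/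
def vectorCompleteLift (X : ∀ x : M, TangentSpace I x) (v : TangentBundle I M) :
    TangentSpace I.tangent v :=
  ((X v.proj : E), mvfderiv I (vectorFieldRep I X v.proj) v.proj v.snd)

/-- The vertical lift of a 1-form: `α^v (a, b) = α (π_* (a, b)) = α(a)`. -/
def formVerticalLift (α : ∀ x : M, TangentSpace I x →L[ℝ] ℝ) (v : TangentBundle I M) :
    TangentSpace I.tangent v →L[ℝ] ℝ :=
  (show E →L[ℝ] ℝ from α v.proj).comp (ContinuousLinearMap.fst ℝ E E)

/-- The complete lift of a 1-form: `α^c = yʲ (∂αᵢ/∂xʲ) dxⁱ + αᵢ dyⁱ`. -/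
def formCompleteLift (α : ∀ x : M, TangentSpace I x →L[ℝ] ℝ) (v : TangentBundle I M) :
    TangentSpace I.tangent v →L[ℝ] ℝ :=
  (mvfderiv I (oneFormRep I α v.proj) v.proj v.snd).comp (ContinuousLinearMap.fst ℝ E E)
    + (show E →L[ℝ] ℝ from α v.proj).comp (ContinuousLinearMap.snd ℝ E E)

/-- The complete lift of a (1,1)-tensor field:
`F^c (a, b) = (F a, y(F) a + F b)`, where `y(F)ⁱₖ = yʲ ∂Fⁱₖ/∂xʲ`. -/
def endoCompleteLift (F : ∀ x : M, TangentSpace I x →L[ℝ] TangentSpace I x)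
    (v : TangentBundle I M) : TangentSpace I.tangent v →L[ℝ] TangentSpace I.tangent v :=
  ((show E →L[ℝ] E from F v.proj).comp (ContinuousLinearMap.fst ℝ E E)).prod
    ((mvfderiv I (endoFieldRep I F v.proj) v.proj v.snd).comp (ContinuousLinearMap.fst ℝ E E)
      + (show E →L[ℝ] E from F v.proj).comp (ContinuousLinearMap.snd ℝ E E))

/-- The (1,1)-tensor field on `TM`
`J = (p/2) I - ((2σ_{p,q} - p)/2) (φ^c + η^v ⊗ ξ^v + η^c ⊗ ξ^c)`. -/
def completeLiftMetallic (p q : ℕ) (φ : ∀ x : M, TangentSpace I x →L[ℝ] TangentSpace I x)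
    (η : ∀ x : M, TangentSpace I x →L[ℝ] ℝ) (ξ : ∀ x : M, TangentSpace I x)
    (v : TangentBundle I M) : TangentSpace I.tangent v →L[ℝ] TangentSpace I.tangent v :=
  ((p : ℝ) / 2) • ContinuousLinearMap.id ℝ (TangentSpace I.tangent v)
    - ((2 * metallicMean p q - p) / 2) •
      (endoCompleteLift I φ v
        + (formVerticalLift I η v).smulRight (vectorVerticalLift I ξ v)
        + (formCompleteLift I η v).smulRight (vectorCompleteLift I ξ v))

end Lifts

set_option linter.unusedSectionVars false

/-! ### The lifts satisfy their defining identities -/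

section LiftIdentities

variable {E : Type*} [NormedAddCommGroup E] [NormedSpace ℝ E]
  {H : Type*} [TopologicalSpace H] {I : ModelWithCorners ℝ E H}
  {M : Type*} [TopologicalSpace M] [ChartedSpace H M] [IsManifold I ∞ M]

theorem trivializationAt_clmAt_self (x : M) :
    (trivializationAt E (TangentSpace I) x).continuousLinearMapAt ℝ x = ContinuousLinearMap.id ℝ E := by
  rw [TangentBundle.continuousLinearMapAt_trivializationAt_eq_core (mem_chart_source H x)]
  ext v
  exact (tangentBundleCore I M).coordChange_self _ _ (mem_chart_source H x) _

theorem trivializationAt_symmL_self (x : M) :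
    (trivializationAt E (TangentSpace I) x).symmL ℝ x = ContinuousLinearMap.id ℝ E := by
  rw [TangentBundle.symmL_trivializationAt_eq_core (mem_chart_source H x)]
  ext v
  exact (tangentBundleCore I M).coordChange_self _ _ (mem_chart_source H x) _

theorem vectorFieldRep_self (X : ∀ x : M, TangentSpace I x) (x : M) : vectorFieldRep I X x x = X x := by
  rw [vectorFieldRep, trivializationAt_clmAt_self]; rfl

theorem oneFormRep_self (α : ∀ x : M, TangentSpace I x →L[ℝ] ℝ) (x : M) : oneFormRep I α x x = α x := by
  rw [oneFormRep, trivializationAt_symmL_self]; rfl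

theorem endoFieldRep_self (F : ∀ x : M, TangentSpace I x →L[ℝ] TangentSpace I x) (x : M) :
    endoFieldRep I F x x = F x := by
  rw [endoFieldRep, trivializationAt_symmL_self, trivializationAt_clmAt_self]; rfl

theorem mdifferentiableAt_vectorFieldRep {X : ∀ x : M, TangentSpace I x} (hX : IsSmoothVectorField I X) (x : M) :
    MDifferentiableAt I 𝓘(ℝ, E) (vectorFieldRep I X x) x := by
  have h := (hX.mdifferentiable (by simp)) x
  have h2 := (mdifferentiableAt_section (F := E) I (E := (TangentSpace I : M → Type _)) X).1 h
  refine h2.congr_of_eventuallyEq ?_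
  filter_upwards [(trivializationAt E (TangentSpace I) x).open_baseSet.mem_nhds
    (mem_baseSet_trivializationAt E (TangentSpace I) x)] with z hz
  rw [vectorFieldRep, Trivialization.continuousLinearMapAt_apply_of_mem _ _ hz]

theorem mdifferentiableAt_oneFormRep {α : ∀ x : M, TangentSpace I x →L[ℝ] ℝ} (h : IsSmoothOneForm I α) (x : M) :
    MDifferentiableAt I 𝓘(ℝ, E →L[ℝ] ℝ) (oneFormRep I α x) x := by
  have h := (h.mdifferentiable (by simp)) x
  have h2 := ((mdifferentiableAt_hom_bundle _).1 h).2
  convert! h2 using 2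
  ext v
  simp [oneFormRep, ContinuousLinearMap.inCoordinates]

theorem mdifferentiableAt_endoFieldRep {F : ∀ x : M, TangentSpace I x →L[ℝ] TangentSpace I x}
    (h : IsSmoothEndoField I F) (x : M) :
    MDifferentiableAt I 𝓘(ℝ, E →L[ℝ] E) (endoFieldRep I F x) x := by
  have h := (h.mdifferentiable (by simp)) x
  exact ((mdifferentiableAt_hom_bundle _).1 h).2

theorem mvfderiv_clm_apply_eq {F₁ F₂ : Type*} [NormedAddCommGroup F₁] [NormedSpace ℝ F₁] [NormedAddCommGroup F₂]
    [NormedSpace ℝ F₂] {g : M → F₁ →L[ℝ] F₂} {f : M → F₁} {x : M}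
    (hg : MDifferentiableAt I 𝓘(ℝ, F₁ →L[ℝ] F₂) g x) (hf : MDifferentiableAt I 𝓘(ℝ, F₁) f x)
    (y : TangentSpace I x) :
    mvfderiv I (fun z => g z (f z)) x y = mvfderiv I g x y (f x) + g x (mvfderiv I f x y) := by
  have h : HasMFDerivAt I 𝓘(ℝ, F₂) (fun z => g z (f z)) x _ :=
    ⟨(hg.clm_apply hf).continuousAt, HasFDerivWithinAt.clm_apply hg.hasMFDerivAt.2 hf.hasMFDerivAt.2⟩
  have e := congrArg (fun L : E →L[ℝ] F₂ => L y) h.mfderiv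
  refine e.trans ?_
  simp [mvfderiv, add_comm]
  rfl

theorem mvfderiv_congr_of_eventuallyEq {F₁ : Type*} [NormedAddCommGroup F₁] [NormedSpace ℝ F₁] {f g : M → F₁} {x : M}
    (h : f =ᶠ[nhds x] g) : mvfderiv I f x = mvfderiv I g x := by
  unfold mvfderiv
  ext y
  have := h.mfderiv_eq (I := I) (I' := 𝓘(ℝ, F₁))
  exact congrArg (fun L : E →L[ℝ] F₁ => L y) this

theorem vectorFieldRep_endo_eventuallyEq (F : ∀ x : M, TangentSpace I x →L[ℝ] TangentSpace I x) (X : ∀ x : M, TangentSpace I x)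
    (x : M) : vectorFieldRep I (fun z => F z (X z)) x =ᶠ[nhds x]
      fun z => endoFieldRep I F x z (vectorFieldRep I X x z) := by
  filter_upwards [(trivializationAt E (TangentSpace I) x).open_baseSet.mem_nhds
    (mem_baseSet_trivializationAt E (TangentSpace I) x)] with z hz
  simp only [vectorFieldRep, endoFieldRep, ContinuousLinearMap.comp_apply]
  rw [Trivialization.symmL_continuousLinearMapAt _ hz]

theorem oneForm_apply_eventuallyEq (α : ∀ x : M, TangentSpace I x →L[ℝ] ℝ) (X : ∀ x : M, TangentSpace I x)
    (x : M) : (fun z => α z (X z)) =ᶠ[nhds x]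
      fun z => oneFormRep I α x z (vectorFieldRep I X x z) := by
  filter_upwards [(trivializationAt E (TangentSpace I) x).open_baseSet.mem_nhds
    (mem_baseSet_trivializationAt E (TangentSpace I) x)] with z hz
  simp only [vectorFieldRep, oneFormRep, ContinuousLinearMap.comp_apply]
  rw [Trivialization.symmL_continuousLinearMapAt _ hz]

theorem endoCompleteLift_vectorCompleteLift {F : ∀ x : M, TangentSpace I x →L[ℝ] TangentSpace I x}
    {X : ∀ x : M, TangentSpace I x} (hF : IsSmoothEndoField I F) (hX : IsSmoothVectorField I X)
    (v : TangentBundle I M) :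
    endoCompleteLift I F v (vectorCompleteLift I X v) = vectorCompleteLift I (fun z => F z (X z)) v := by
  unfold vectorCompleteLift
  rw [mvfderiv_congr_of_eventuallyEq (vectorFieldRep_endo_eventuallyEq F X v.proj), mvfderiv_clm_apply_eq (mdifferentiableAt_endoFieldRep hF _) (mdifferentiableAt_vectorFieldRep hX _), vectorFieldRep_self, endoFieldRep_self]
  rfl

theorem endoCompleteLift_vectorVerticalLift (F : ∀ x : M, TangentSpace I x →L[ℝ] TangentSpace I x)
    (X : ∀ x : M, TangentSpace I x) 
    (v : TangentBundle I M) :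
    endoCompleteLift I F v (vectorVerticalLift I X v) = vectorVerticalLift I (fun z => F z (X z)) v := by
  unfold vectorVerticalLift endoCompleteLift
  refine Prod.ext ?_ ?_
  · exact (F v.proj).map_zero
  · refine (congrArg (fun z : E => z + (show E →L[ℝ] E from F v.proj) (X v.proj)) (map_zero (mvfderiv I (endoFieldRep I F v.proj) v.proj v.snd))).trans ?_
    exact zero_add _

theorem formCompleteLift_vectorCompleteLift {α : ∀ x : M, TangentSpace I x →L[ℝ] ℝ}
    {X : ∀ x : M, TangentSpace I x} (hF : IsSmoothOneForm I α) (hX : IsSmoothVectorField I X)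
    (v : TangentBundle I M) :
    formCompleteLift I α v (vectorCompleteLift I X v) = funCompleteLift I (fun z => α z (X z)) v := by
  unfold funCompleteLift
  rw [mvfderiv_congr_of_eventuallyEq (oneForm_apply_eventuallyEq α X v.proj), mvfderiv_clm_apply_eq (mdifferentiableAt_oneFormRep hF _) (mdifferentiableAt_vectorFieldRep hX _), vectorFieldRep_self, oneFormRep_self]
  rfl

theorem formCompleteLift_vectorVerticalLift (α : ∀ x : M, TangentSpace I x →L[ℝ] ℝ) (X : ∀ x : M, TangentSpace I x)
    (v : TangentBundle I M) :
    formCompleteLift I α v (vectorVerticalLift I X v) = funVerticalLift I (fun z => α z (X z)) v := by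
  change (mvfderiv I (oneFormRep I α v.proj) v.proj v.snd) 0 + α v.proj (X v.proj) = _
  rw [map_zero, zero_add]; rfl

/-- In the identification of the fibre of `T(TM)` with `E × E`, the derivative of `π` is the first
projection. -/
theorem hasMFDerivAt_tangentBundle_proj (v : TangentBundle I M) :
    HasMFDerivAt I.tangent I (TotalSpace.proj : TangentBundle I M → M) v
      (ContinuousLinearMap.fst ℝ E E) := by
  refine ⟨(FiberBundle.continuous_proj E (TangentSpace I : M → Type _)).continuousAt, ?_⟩
  have : Set.EqOn (writtenInExtChartAt I.tangent I v (TotalSpace.proj : TangentBundle I M → M))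
      Prod.fst (extChartAt I.tangent v).target := by
    intro z hz
    have hz' : z.1 ∈ (extChartAt I v.proj).target := by
      have := (extChartAt I.tangent v).map_target hz
      have h3 : ((extChartAt I.tangent v).symm z).proj ∈ (chartAt H v.proj).source := by
        simpa using this
      have h4 : extChartAt I v.proj ((extChartAt I.tangent v).symm z).proj = z.1 :=
        congrArg Prod.fst ((extChartAt I.tangent v).right_inv hz)
      rw [← h4]
      exact (extChartAt I v.proj).map_source (by simpa using h3)
    exact (extChartAt I v.proj).right_inv hz'
  have e := (this.eventuallyEq_of_mem (extChartAt_target_mem_nhdsWithin (I := I.tangent) v))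
  exact (hasFDerivWithinAt_fst).congr_of_eventuallyEq e (this (mem_extChartAt_target v))

/-- In the identification of the fibre of `T(TM)` with `E × E`, the derivative of the fibre
coordinates `y` of the induced chart is the second projection. -/
theorem hasMFDerivAt_tangentBundle_fiberCoord (v : TangentBundle I M) :
    HasMFDerivAt I.tangent 𝓘(ℝ, E) (fun q : TangentBundle I M =>
      (trivializationAt E (TangentSpace I) v.proj q).2) v
      (ContinuousLinearMap.snd ℝ E E) := by
  have h0 : Set.EqOn (writtenInExtChartAt I.tangent 𝓘(ℝ, E) v (fun q : TangentBundle I M =>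
      (trivializationAt E (TangentSpace I) v.proj q).2))
      Prod.snd (extChartAt I.tangent v).target := by
    intro z hz
    exact congrArg Prod.snd ((extChartAt I.tangent v).right_inv hz)
  have e := (h0.eventuallyEq_of_mem (extChartAt_target_mem_nhdsWithin (I := I.tangent) v))
  refine ⟨?_, (hasFDerivWithinAt_snd).congr_of_eventuallyEq e (h0 (mem_extChartAt_target v))⟩
  exact (continuous_snd.continuousAt).comp
    ((trivializationAt E (TangentSpace I) v.proj).continuousOn.continuousAt
      ((trivializationAt E (TangentSpace I) v.proj).open_source.mem_nhds (by simp)))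

end LiftIdentities

end

/-! Put P = φ^c + η^v ⊗ ξ^v + η^c ⊗ ξ^c and s = (2σ_{p,q} - p)/2, so that J = (p/2) I - s P. It
suffices that P is smooth, P² = I and N_P = 0. Indeed s² = p²/4 + q (`sq_metallicMean_sub`) turns P²
= I into J² = pJ + qI, and N_J = s² N_P because a constant multiple of the identity contributes
nothing to the Nijenhuis tensor (`flatNijenhuis_smul_id_sub_smul`).

P² = I is the algebra of lifts. Lifting φ² = I - η ⊗ ξ gives (φ^c)² = I - η^v ⊗ ξ^c - η^c ⊗ ξ^v, and
since η^v(ξ^c) = η^c(ξ^v) = 1 while the other two pairings vanish, the rank-two part of P squares to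
exactly the missing terms.

For N_P = 0, the P-Sasakian equation at Y = ξ gives ∇ξ = φ. As φ is self-adjoint and ∇ is metric and
torsion-free, it follows that dη = 0, L_ξ φ = 0 and N_φ = 0 (`mvfderiv_eta_sub`,
`mlieBracket_xi_phi`, `nijenhuis_phi`). The metric and the connection play no further role. These
properties pass to the lifts: N of φ^c vanishes, η^v and η^c are closed and killed by φ^c, and ξ^v
and ξ^c commute, preserve φ^c and lie in its kernel. `flatNijenhuis_add_smulRight_eq_zero` then
gives N_P = 0.

The computation takes place in one induced chart of TM. Since each lift at v is written in the
preferred chart at the base point of v, its components must first be transported to a fixed chart.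
The terms with second derivatives of the transition map match because these are symmetric
(`mvfderiv_chartChange_symm`). -/

noncomputable section

/-! ### The Nijenhuis tensor on a normed space -/

section Flat

variable {W : Type*} [NormedAddCommGroup W] [NormedSpace ℝ W]

/-- The Nijenhuis tensor of a field of endomorphisms of a normed space. -/
def flatNijenhuis (J : W → W →L[ℝ] W) (w u v : W) : W :=
  fderiv ℝ J w (J w u) v - fderiv ℝ J w (J w v) u
    - J w (fderiv ℝ J w u v) + J w (fderiv ℝ J w v u)

/-- Tensoriality: after the product rule all derivatives of X and Y cancel, leaving only their
values at w. -/
theorem lieBracket_endo_eq_flatNijenhuis {J : W → W →L[ℝ] W} {X Y : W → W} {w : W}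
    (hJ : DifferentiableAt ℝ J w) (hX : DifferentiableAt ℝ X w) (hY : DifferentiableAt ℝ Y w) :
    lieBracket ℝ (fun z => J z (X z)) (fun z => J z (Y z)) w
      - J w (lieBracket ℝ (fun z => J z (X z)) Y w)
      - J w (lieBracket ℝ X (fun z => J z (Y z)) w)
      + J w (J w (lieBracket ℝ X Y w)) = flatNijenhuis J w (X w) (Y w) := by
  simp only [lieBracket, fderiv_clm_apply hJ hX, fderiv_clm_apply hJ hY, flatNijenhuis,
    add_apply, ContinuousLinearMap.comp_apply,
    ContinuousLinearMap.flip_apply, map_sub, map_add]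
  abel

theorem flatNijenhuis_smul_id_sub_smul {F : W → W →L[ℝ] W} {w : W} (hF : DifferentiableAt ℝ F w)
    (c s : ℝ) (u v : W) :
    flatNijenhuis (fun z => c • ContinuousLinearMap.id ℝ W - s • F z) w u v
      = s ^ 2 • flatNijenhuis F w u v := by
  have h : fderiv ℝ (fun z => c • ContinuousLinearMap.id ℝ W - s • F z) w
      = -(s • fderiv ℝ F w) := by
    rw [fderiv_const_sub, fderiv_fun_const_smul hF]
  simp only [flatNijenhuis, h]
  simp only [sub_apply, smul_apply,
    neg_apply, ContinuousLinearMap.id_apply, map_sub, map_smul, map_neg]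
  module

theorem smulRight_differentiableAt {α : W → W →L[ℝ] ℝ} {A : W → W} {w : W}
    (dα : DifferentiableAt ℝ α w) (dA : DifferentiableAt ℝ A w) :
    DifferentiableAt ℝ (fun z => (α z).smulRight (A z)) w :=
  ((ContinuousLinearMap.smulRightL ℝ W W).differentiableAt.comp w dα).clm_apply dA

/-- Adding to an integrable endomorphism field `Ψ` a sum `α ⊗ A + β ⊗ B`, where `α`, `β` are
closed forms killed by `Ψ` and `A`, `B` are commuting symmetries of `Ψ` in its kernel, keeps it
integrable, provided the pairings of the forms with the fields are constant. -/
theorem flatNijenhuis_add_smulRight_eq_zero {Ψ : W → W →L[ℝ] W} {α β : W → W →L[ℝ] ℝ}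
    {A B : W → W} {w : W}
    (dΨ : DifferentiableAt ℝ Ψ w) (dα : DifferentiableAt ℝ α w) (dβ : DifferentiableAt ℝ β w)
    (dA : DifferentiableAt ℝ A w) (dB : DifferentiableAt ℝ B w)
    (hN : ∀ u v, flatNijenhuis Ψ w u v = 0)
    (hα : ∀ u v, fderiv ℝ α w u v = fderiv ℝ α w v u)
    (hβ : ∀ u v, fderiv ℝ β w u v = fderiv ℝ β w v u)
    (hΨA0 : Ψ w (A w) = 0) (hΨB0 : Ψ w (B w) = 0)
    (hαΨ : ∀ u v, fderiv ℝ α w u (Ψ w v) + α w (fderiv ℝ Ψ w u v) = 0)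
    (hβΨ : ∀ u v, fderiv ℝ β w u (Ψ w v) + β w (fderiv ℝ Ψ w u v) = 0)
    (hA : ∀ v, fderiv ℝ Ψ w (A w) v - fderiv ℝ A w (Ψ w v) + Ψ w (fderiv ℝ A w v) = 0)
    (hB : ∀ v, fderiv ℝ Ψ w (B w) v - fderiv ℝ B w (Ψ w v) + Ψ w (fderiv ℝ B w v) = 0)
    (hαA : ∀ u, fderiv ℝ α w u (A w) + α w (fderiv ℝ A w u) = 0)
    (hαB : ∀ u, fderiv ℝ α w u (B w) + α w (fderiv ℝ B w u) = 0)
    (hβA : ∀ u, fderiv ℝ β w u (A w) + β w (fderiv ℝ A w u) = 0)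
    (hβB : ∀ u, fderiv ℝ β w u (B w) + β w (fderiv ℝ B w u) = 0)
    (hAB : fderiv ℝ B w (A w) = fderiv ℝ A w (B w)) (u v : W) :
    flatNijenhuis (fun z => Ψ z + (α z).smulRight (A z) + (β z).smulRight (B z)) w u v = 0 := by
  have hF : ∀ a b, fderiv ℝ (fun z => Ψ z + (α z).smulRight (A z) + (β z).smulRight (B z)) w a b
      = fderiv ℝ Ψ w a b + (fderiv ℝ α w a b • A w + α w b • fderiv ℝ A w a)
        + (fderiv ℝ β w a b • B w + β w b • fderiv ℝ B w a) := by
    -- With b frozen, the field becomes vector-valued and the product rule for scalar times vector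
    -- applies. Uniqueness of the derivative carries the result back to the operator-valued field.
    intro a b
    have key : HasFDerivAt
        (fun z => (Ψ z + (α z).smulRight (A z) + (β z).smulRight (B z)) b) _ w :=
      ((dΨ.hasFDerivAt.clm_apply (hasFDerivAt_const b w)).add
        ((dα.hasFDerivAt.clm_apply (hasFDerivAt_const b w)).smul dA.hasFDerivAt)).add
        ((dβ.hasFDerivAt.clm_apply (hasFDerivAt_const b w)).smul dB.hasFDerivAt)
    have hd : DifferentiableAt ℝ
        (fun z => Ψ z + (α z).smulRight (A z) + (β z).smulRight (B z)) w :=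
      (dΨ.add (smulRight_differentiableAt dα dA)).add (smulRight_differentiableAt dβ dB)
    have e := (hd.hasFDerivAt.clm_apply (hasFDerivAt_const b w)).unique key
    have e' := congrArg (fun L : W →L[ℝ] W => L a) e
    simp at e'
    rw [e']
    abel
  have N := hN u v
  simp only [flatNijenhuis] at N ⊢
  simp only [hF]
  simp only [add_apply, smul_apply, ContinuousLinearMap.smulRight_apply, map_add, map_smul, smul_add,
    add_smul, hΨA0, hΨB0]
  -- With γ = α or β this is half of the coefficient of A or B in the Nijenhuis tensor. Closedness
  -- swaps the arguments of Dγ, and each bracket becomes the derivative of a constant: γ ∘ Ψ, γ(A)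
  -- or γ(B).
  have coef : ∀ γ : W → W →L[ℝ] ℝ, (∀ u v, fderiv ℝ γ w u v = fderiv ℝ γ w v u) →
      (∀ u v, fderiv ℝ γ w u (Ψ w v) + γ w (fderiv ℝ Ψ w u v) = 0) →
      (∀ u, fderiv ℝ γ w u (A w) + γ w (fderiv ℝ A w u) = 0) →
      (∀ u, fderiv ℝ γ w u (B w) + γ w (fderiv ℝ B w u) = 0) → ∀ u v,
      fderiv ℝ γ w (Ψ w u) v + γ w (fderiv ℝ Ψ w v u)
        + α w u * (fderiv ℝ γ w (A w) v + γ w (fderiv ℝ A w v))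
        + β w u * (fderiv ℝ γ w (B w) v + γ w (fderiv ℝ B w v)) = 0 := by
    intro γ hγ hγΨ hγA hγB u v
    linear_combination hγ (Ψ w u) v + hγΨ v u + α w u * (hγ (A w) v + hγA v)
      + β w u * (hγ (B w) v + hγB v)
  -- The expansion groups into N_Ψ, the Lie derivatives of Ψ along A and B weighted by α and β, the
  -- coefficients of A and B, multiples of dα and dβ, and (α ∧ β)(u, v) times [A, B].
  linear_combination (norm := module) N + α w u • hA v - α w v • hA u + β w u • hB v - β w v • hB u
    + (coef α hα hαΨ hαA hαB u v) • A w - (coef α hα hαΨ hαA hαB v u) • A w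
    + (coef β hβ hβΨ hβA hβB u v) • B w - (coef β hβ hβΨ hβA hβB v u) • B w
    - (α w (A w) * hα u v + α w (B w) * hβ u v) • A w
    - (β w (A w) * hα u v + β w (B w) * hβ u v) • B w
    + (α w u * β w v - β w u * α w v) • hAB

end Flat

/-! ### Lifts on a normed space and their derivatives -/

section FlatLifts

variable {E : Type*} [NormedAddCommGroup E] [NormedSpace ℝ E]

/-- The vertical lift of a vector field on a normed space. -/
def flatVectorVerticalLift (X : E → E) (p : E × E) : E × E := (0, X p.1)

/-- The complete lift of a vector field on a normed space. -/
def flatVectorCompleteLift (X : E → E) (p : E × E) : E × E := (X p.1, fderiv ℝ X p.1 p.2)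

/-- The vertical lift of a 1-form on a normed space. -/
def flatFormVerticalLift (α : E → E →L[ℝ] ℝ) (p : E × E) : E × E →L[ℝ] ℝ :=
  (α p.1).comp (ContinuousLinearMap.fst ℝ E E)

/-- The complete lift of a 1-form on a normed space. -/
def flatFormCompleteLift (α : E → E →L[ℝ] ℝ) (p : E × E) : E × E →L[ℝ] ℝ :=
  (fderiv ℝ α p.1 p.2).comp (ContinuousLinearMap.fst ℝ E E)
    + (α p.1).comp (ContinuousLinearMap.snd ℝ E E)

/-- The complete lift of an endomorphism field on a normed space. -/
def flatEndoCompleteLift (F : E → E →L[ℝ] E) (p : E × E) : E × E →L[ℝ] E × E :=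
  ((F p.1).comp (ContinuousLinearMap.fst ℝ E E)).prod
    ((fderiv ℝ F p.1 p.2).comp (ContinuousLinearMap.fst ℝ E E)
      + (F p.1).comp (ContinuousLinearMap.snd ℝ E E))

/-- The endomorphism field `φ^c + η^v ⊗ ξ^v + η^c ⊗ ξ^c` on a normed space. -/
def flatProductLift (φ : E → E →L[ℝ] E) (η : E → E →L[ℝ] ℝ) (ξ : E → E) (p : E × E) :
    E × E →L[ℝ] E × E :=
  flatEndoCompleteLift φ p
    + (flatFormVerticalLift η p).smulRight (flatVectorVerticalLift ξ p)
    + (flatFormCompleteLift η p).smulRight (flatVectorCompleteLift ξ p)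

section Smoothness

variable {G : Type*} [NormedAddCommGroup G] [NormedSpace ℝ G] {p : E × E}

theorem contDiffAt_comp_fst {f : E → G} (h : ContDiffAt ℝ ∞ f p.1) :
    ContDiffAt ℝ ∞ (fun q : E × E => f q.1) p :=
  h.comp p contDiffAt_fst

theorem contDiffAt_fderiv_fst_snd {f : E → G} (h : ContDiffAt ℝ ∞ f p.1) :
    ContDiffAt ℝ ∞ (fun q : E × E => fderiv ℝ f q.1 q.2) p :=
  (contDiffAt_comp_fst (h.fderiv_right (m := ∞) (by simp))).clm_apply contDiffAt_snd

theorem contDiffAt_flatVectorVerticalLift {X : E → E} (h : ContDiffAt ℝ ∞ X p.1) :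
    ContDiffAt ℝ ∞ (flatVectorVerticalLift X) p :=
  contDiffAt_const.prodMk (contDiffAt_comp_fst h)

theorem contDiffAt_flatVectorCompleteLift {X : E → E} (h : ContDiffAt ℝ ∞ X p.1) :
    ContDiffAt ℝ ∞ (flatVectorCompleteLift X) p :=
  (contDiffAt_comp_fst h).prodMk (contDiffAt_fderiv_fst_snd h)

theorem contDiffAt_flatFormVerticalLift {α : E → E →L[ℝ] ℝ} (h : ContDiffAt ℝ ∞ α p.1) :
    ContDiffAt ℝ ∞ (flatFormVerticalLift α) p :=
  (contDiffAt_comp_fst h).clm_comp contDiffAt_const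

theorem contDiffAt_flatFormCompleteLift {α : E → E →L[ℝ] ℝ} (h : ContDiffAt ℝ ∞ α p.1) :
    ContDiffAt ℝ ∞ (flatFormCompleteLift α) p :=
  ((contDiffAt_fderiv_fst_snd h).clm_comp contDiffAt_const).add
    ((contDiffAt_comp_fst h).clm_comp contDiffAt_const)

theorem contDiffAt_flatEndoCompleteLift {F : E → E →L[ℝ] E} (h : ContDiffAt ℝ ∞ F p.1) :
    ContDiffAt ℝ ∞ (flatEndoCompleteLift F) p := by
  -- The pairing of two operators is rewritten through the inclusions of the factors, so that
  -- smoothness follows from composition and addition.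
  have : flatEndoCompleteLift F = fun q =>
      (ContinuousLinearMap.inl ℝ E E).comp ((F q.1).comp (ContinuousLinearMap.fst ℝ E E))
      + (ContinuousLinearMap.inr ℝ E E).comp
        ((fderiv ℝ F q.1 q.2).comp (ContinuousLinearMap.fst ℝ E E)
          + (F q.1).comp (ContinuousLinearMap.snd ℝ E E)) := by
    funext q
    ext v <;> simp [flatEndoCompleteLift]
  rw [this]
  exact (contDiffAt_const.clm_comp ((contDiffAt_comp_fst h).clm_comp contDiffAt_const)).add
    (contDiffAt_const.clm_comp (((contDiffAt_fderiv_fst_snd h).clm_comp contDiffAt_const).add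
    ((contDiffAt_comp_fst h).clm_comp contDiffAt_const)))

theorem contDiffAt_smulRight {V : Type*} [NormedAddCommGroup V] [NormedSpace ℝ V]
    {α : V → V →L[ℝ] ℝ} {A : V → V} {w : V} (dα : ContDiffAt ℝ ∞ α w) (dA : ContDiffAt ℝ ∞ A w) :
    ContDiffAt ℝ ∞ (fun z => (α z).smulRight (A z)) w :=
  ((ContinuousLinearMap.smulRightL ℝ V V).contDiff.contDiffAt.comp w dα).clm_apply dA

theorem contDiffAt_flatProductLift {φ : E → E →L[ℝ] E} {η : E → E →L[ℝ] ℝ} {ξ : E → E}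
    (hφ : ContDiffAt ℝ ∞ φ p.1) (hη : ContDiffAt ℝ ∞ η p.1) (hξ : ContDiffAt ℝ ∞ ξ p.1) :
    ContDiffAt ℝ ∞ (flatProductLift φ η ξ) p :=
  ((contDiffAt_flatEndoCompleteLift hφ).add (contDiffAt_smulRight
    (contDiffAt_flatFormVerticalLift hη) (contDiffAt_flatVectorVerticalLift hξ))).add
    (contDiffAt_smulRight
    (contDiffAt_flatFormCompleteLift hη) (contDiffAt_flatVectorCompleteLift hξ))

end Smoothness

section Derivatives

variable {G : Type*} [NormedAddCommGroup G] [NormedSpace ℝ G] {x y : E}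

theorem hasFDerivAt_comp_fst {f : E → G} (h : ContDiffAt ℝ ∞ f x) (y : E) :
    HasFDerivAt (fun q : E × E => f q.1) ((fderiv ℝ f x).comp (ContinuousLinearMap.fst ℝ E E))
      (x, y) :=
  HasFDerivAt.comp (x, y) (h.differentiableAt (by simp)).hasFDerivAt hasFDerivAt_fst

/-- Product rule for (x, y) ↦ Df(x) y. In the second derivative the base direction comes first and y
second; later symmetry arguments exchange these slots. -/
theorem hasFDerivAt_fderiv_fst_snd {f : E → G} (h : ContDiffAt ℝ ∞ f x) (y : E) :
    HasFDerivAt (fun q : E × E => fderiv ℝ f q.1 q.2)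
      ((fderiv ℝ f x).comp (ContinuousLinearMap.snd ℝ E E)
        + (((fderiv ℝ (fderiv ℝ f) x).comp (ContinuousLinearMap.fst ℝ E E)).flip y))
      (x, y) :=
  (hasFDerivAt_comp_fst (h.fderiv_right (m := ∞) (by simp)) y).clm_apply hasFDerivAt_snd

/-- Evaluation at a fixed vector is linear and continuous, so the derivative of an operator field
can be read off from that of its evaluation at c. -/
theorem fderiv_clm_eq_of_forall {V G₁ : Type*} [NormedAddCommGroup V] [NormedSpace ℝ V]
    [NormedAddCommGroup G₁] [NormedSpace ℝ G₁]
    {f : V → G →L[ℝ] G₁} {w : V} (h : DifferentiableAt ℝ f w) {c : G} {f' : V →L[ℝ] G₁}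
    (hc : HasFDerivAt (fun z => f z c) f' w) (u : V) : fderiv ℝ f w u c = f' u := by
  have e := (h.hasFDerivAt.clm_apply (hasFDerivAt_const c w)).unique hc
  simpa using congrArg (fun L : V →L[ℝ] G₁ => L u) e

theorem fderiv_flatVectorVerticalLift {X : E → E} (h : ContDiffAt ℝ ∞ X x) (a b : E) :
    fderiv ℝ (flatVectorVerticalLift X) (x, y) (a, b) = (0, fderiv ℝ X x a) := by
  have := (hasFDerivAt_const (0 : E) (x, y)).prodMk (hasFDerivAt_comp_fst h y)
  exact congrArg (fun L : E × E →L[ℝ] E × E => L (a, b)) this.fderiv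

theorem fderiv_flatVectorCompleteLift {X : E → E} (h : ContDiffAt ℝ ∞ X x) (a b : E) :
    fderiv ℝ (flatVectorCompleteLift X) (x, y) (a, b)
      = (fderiv ℝ X x a, fderiv ℝ X x b + fderiv ℝ (fderiv ℝ X) x a y) := by
  have := (hasFDerivAt_comp_fst h y).prodMk (hasFDerivAt_fderiv_fst_snd h y)
  exact congrArg (fun L : E × E →L[ℝ] E × E => L (a, b)) this.fderiv

theorem fderiv_flatFormVerticalLift {α : E → E →L[ℝ] ℝ} (h : ContDiffAt ℝ ∞ α x) (a b c d : E) :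
    fderiv ℝ (flatFormVerticalLift α) (x, y) (a, b) (c, d) = fderiv ℝ α x a c := by
  have := (hasFDerivAt_comp_fst h y).clm_apply (hasFDerivAt_const c _)
  refine (fderiv_clm_eq_of_forall ((contDiffAt_flatFormVerticalLift (p := (x, y))
    h).differentiableAt (by simp)) this (a, b)).trans ?_
  simp

theorem fderiv_flatFormCompleteLift {α : E → E →L[ℝ] ℝ} (h : ContDiffAt ℝ ∞ α x) (a b c d : E) :
    fderiv ℝ (flatFormCompleteLift α) (x, y) (a, b) (c, d)
      = fderiv ℝ α x b c + fderiv ℝ (fderiv ℝ α) x a y c + fderiv ℝ α x a d := by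
  have := ((hasFDerivAt_fderiv_fst_snd h y).clm_apply (hasFDerivAt_const c _)).add
    ((hasFDerivAt_comp_fst h y).clm_apply (hasFDerivAt_const d _))
  refine (fderiv_clm_eq_of_forall ((contDiffAt_flatFormCompleteLift (p := (x, y))
    h).differentiableAt (by simp)) this (a, b)).trans ?_
  simp

theorem fderiv_flatEndoCompleteLift {F : E → E →L[ℝ] E} (h : ContDiffAt ℝ ∞ F x) (a b c d : E) :
    fderiv ℝ (flatEndoCompleteLift F) (x, y) (a, b) (c, d)
      = (fderiv ℝ F x a c,
        fderiv ℝ F x b c + fderiv ℝ (fderiv ℝ F) x a y c + fderiv ℝ F x a d) := by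
  have := ((hasFDerivAt_comp_fst h y).clm_apply (hasFDerivAt_const c _)).prodMk
    (((hasFDerivAt_fderiv_fst_snd h y).clm_apply (hasFDerivAt_const c _)).add
    ((hasFDerivAt_comp_fst h y).clm_apply (hasFDerivAt_const d _)))
  refine (fderiv_clm_eq_of_forall ((contDiffAt_flatEndoCompleteLift (p := (x, y))
    h).differentiableAt (by simp)) this (a, b)).trans ?_
  simp

end Derivatives

end FlatLifts

/-! ### Normal paracontact structures in a chart: differentiated identities, algebra of the lifts,
integrability -/

section FlatNormal

set_option synthInstance.maxHeartbeats 200000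

variable {E : Type*} [NormedAddCommGroup E] [NormedSpace ℝ E]

/-- An almost paracontact structure on an open subset `U` of a normed space which is normal, has a
closed form `η` and is invariant under the flow of `ξ`. -/
structure IsFlatNormalParacontact (U : Set E) (φ : E → E →L[ℝ] E) (η : E → E →L[ℝ] ℝ)
    (ξ : E → E) : Prop where
  isOpen : IsOpen U
  smooth_phi : ∀ z ∈ U, ContDiffAt ℝ ∞ φ z
  smooth_eta : ∀ z ∈ U, ContDiffAt ℝ ∞ η z
  smooth_xi : ∀ z ∈ U, ContDiffAt ℝ ∞ ξ z
  phi_phi : ∀ z ∈ U, ∀ v, φ z (φ z v) = v - η z v • ξ z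
  eta_xi : ∀ z ∈ U, η z (ξ z) = 1
  phi_xi : ∀ z ∈ U, φ z (ξ z) = 0
  eta_phi : ∀ z ∈ U, ∀ v, η z (φ z v) = 0
  closed : ∀ z ∈ U, ∀ u v, fderiv ℝ η z u v = fderiv ℝ η z v u
  invariant : ∀ z ∈ U, ∀ v,
    fderiv ℝ φ z (ξ z) v - fderiv ℝ ξ z (φ z v) + φ z (fderiv ℝ ξ z v) = 0
  normal : ∀ z ∈ U, ∀ u v, flatNijenhuis φ z u v = 0

theorem two_le_infty : (2 : WithTop ℕ∞) ≤ ∞ :=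
  WithTop.coe_le_coe.2 (le_top : (2 : ℕ∞) ≤ ⊤)

/-- The device for differentiating a structure identity that holds throughout an open set: `f'` is
the expression produced by the product rule. -/
theorem eq_zero_of_hasFDerivAt_of_const {V G : Type*} [NormedAddCommGroup V] [NormedSpace ℝ V]
    [NormedAddCommGroup G] [NormedSpace ℝ G] {U : Set V} (hU : IsOpen U) {x : V} (hx : x ∈ U)
    {f : V → G} {f' : V →L[ℝ] G} {c : G} (hf : ∀ z ∈ U, f z = c) (h : HasFDerivAt f f' x) (a : V) :
    f' a = 0 := by
  have h0 : HasFDerivAt f (0 : V →L[ℝ] G) x :=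
    (hasFDerivAt_const c x).congr_of_eventuallyEq
      (Filter.eventually_of_mem (hU.mem_nhds hx) hf)
  rw [h.unique h0, zero_apply]

namespace IsFlatNormalParacontact

variable {U : Set E} {φ : E → E →L[ℝ] E} {η : E → E →L[ℝ] ℝ} {ξ : E → E}
  (H : IsFlatNormalParacontact U φ η ξ) {x : E} (hx : x ∈ U)

include H hx

theorem hasFDerivAt_phi : HasFDerivAt φ (fderiv ℝ φ x) x :=
  ((H.smooth_phi x hx).differentiableAt (by simp)).hasFDerivAt

theorem hasFDerivAt_eta : HasFDerivAt η (fderiv ℝ η x) x :=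
  ((H.smooth_eta x hx).differentiableAt (by simp)).hasFDerivAt

theorem hasFDerivAt_xi : HasFDerivAt ξ (fderiv ℝ ξ x) x :=
  ((H.smooth_xi x hx).differentiableAt (by simp)).hasFDerivAt

theorem hasFDerivAt_fderiv_phi : HasFDerivAt (fderiv ℝ φ) (fderiv ℝ (fderiv ℝ φ) x) x :=
  (((H.smooth_phi x hx).fderiv_right (m := ∞) (by simp)).differentiableAt (by simp)).hasFDerivAt

theorem hasFDerivAt_fderiv_eta : HasFDerivAt (fderiv ℝ η) (fderiv ℝ (fderiv ℝ η) x) x :=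
  (((H.smooth_eta x hx).fderiv_right (m := ∞) (by simp)).differentiableAt (by simp)).hasFDerivAt

theorem hasFDerivAt_fderiv_xi : HasFDerivAt (fderiv ℝ ξ) (fderiv ℝ (fderiv ℝ ξ) x) x :=
  (((H.smooth_xi x hx).fderiv_right (m := ∞) (by simp)).differentiableAt (by simp)).hasFDerivAt

theorem fderiv_phi_phi (a v : E) : fderiv ℝ φ x a (φ x v) + φ x (fderiv ℝ φ x a v)
    + (fderiv ℝ η x a v • ξ x + η x v • fderiv ℝ ξ x a) = 0 := by
  have h1 := H.hasFDerivAt_phi hx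
  have h2 := H.hasFDerivAt_eta hx
  have c := hasFDerivAt_const (𝕜 := ℝ) v x
  have := eq_zero_of_hasFDerivAt_of_const H.isOpen hx (c := v)
    (fun z hz => by simp [H.phi_phi z hz]) ((h1.clm_apply (h1.clm_apply c)).add
      ((h2.clm_apply c).smul (H.hasFDerivAt_xi hx))) a
  simp at this
  rw [← this]
  abel

theorem fderiv_eta_xi (a : E) : fderiv ℝ η x a (ξ x) + η x (fderiv ℝ ξ x a) = 0 := by
  have := eq_zero_of_hasFDerivAt_of_const H.isOpen hx (c := 1) H.eta_xi
    ((H.hasFDerivAt_eta hx).clm_apply (H.hasFDerivAt_xi hx)) a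
  simpa [add_comm] using this

theorem fderiv_phi_xi (a : E) : fderiv ℝ φ x a (ξ x) + φ x (fderiv ℝ ξ x a) = 0 := by
  have := eq_zero_of_hasFDerivAt_of_const H.isOpen hx (c := 0) H.phi_xi
    ((H.hasFDerivAt_phi hx).clm_apply (H.hasFDerivAt_xi hx)) a
  simpa [add_comm] using this

theorem fderiv_eta_phi (a v : E) : fderiv ℝ η x a (φ x v) + η x (fderiv ℝ φ x a v) = 0 := by
  have := eq_zero_of_hasFDerivAt_of_const H.isOpen hx (c := 0) (fun z hz => H.eta_phi z hz v)
    ((H.hasFDerivAt_eta hx).clm_apply ((H.hasFDerivAt_phi hx).clm_apply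
      (hasFDerivAt_const (𝕜 := ℝ) v x))) a
  simpa [add_comm] using this

theorem fderiv_closed (a u v : E) :
    fderiv ℝ (fderiv ℝ η) x a u v = fderiv ℝ (fderiv ℝ η) x a v u := by
  have h := H.hasFDerivAt_fderiv_eta hx
  have := eq_zero_of_hasFDerivAt_of_const H.isOpen hx (c := 0)
    (fun z hz => sub_eq_zero.2 (H.closed z hz u v))
    (((h.clm_apply (hasFDerivAt_const (𝕜 := ℝ) u x)).clm_apply (hasFDerivAt_const (𝕜 := ℝ) v x)).sub
    ((h.clm_apply (hasFDerivAt_const (𝕜 := ℝ) v x)).clm_apply (hasFDerivAt_const (𝕜 := ℝ) u x))) a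
  simpa [sub_eq_zero] using this

theorem fderiv_invariant (a v : E) :
    fderiv ℝ (fderiv ℝ φ) x a (ξ x) v + fderiv ℝ φ x (fderiv ℝ ξ x a) v
      - fderiv ℝ (fderiv ℝ ξ) x a (φ x v) - fderiv ℝ ξ x (fderiv ℝ φ x a v)
      + fderiv ℝ φ x a (fderiv ℝ ξ x v) + φ x (fderiv ℝ (fderiv ℝ ξ) x a v) = 0 := by
  have h1 := H.hasFDerivAt_phi hx
  have h1' := H.hasFDerivAt_fderiv_phi hx
  have h2' := H.hasFDerivAt_fderiv_xi hx
  have c := hasFDerivAt_const (𝕜 := ℝ) v x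
  have := eq_zero_of_hasFDerivAt_of_const H.isOpen hx (fun z hz => H.invariant z hz v)
    ((((h1'.clm_apply (H.hasFDerivAt_xi hx)).clm_apply c).sub
      (h2'.clm_apply (h1.clm_apply c))).add (h1.clm_apply (h2'.clm_apply c))) a
  simp at this
  rw [← this]
  abel

theorem fderiv_normal (a u v : E) :
    fderiv ℝ (fderiv ℝ φ) x a (φ x u) v + fderiv ℝ φ x (fderiv ℝ φ x a u) v
      - (fderiv ℝ (fderiv ℝ φ) x a (φ x v) u + fderiv ℝ φ x (fderiv ℝ φ x a v) u)
      - (fderiv ℝ φ x a (fderiv ℝ φ x u v) + φ x (fderiv ℝ (fderiv ℝ φ) x a u v))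
      + (fderiv ℝ φ x a (fderiv ℝ φ x v u) + φ x (fderiv ℝ (fderiv ℝ φ) x a v u)) = 0 := by
  have h := H.hasFDerivAt_phi hx
  have h' := H.hasFDerivAt_fderiv_phi hx
  have cu := hasFDerivAt_const (𝕜 := ℝ) u x
  have cv := hasFDerivAt_const (𝕜 := ℝ) v x
  have := eq_zero_of_hasFDerivAt_of_const H.isOpen hx (fun z hz => H.normal z hz u v)
    (((((h'.clm_apply (h.clm_apply cu)).clm_apply cv).sub
      ((h'.clm_apply (h.clm_apply cv)).clm_apply cu)).sub
      (h.clm_apply ((h'.clm_apply cu).clm_apply cv))).add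
      (h.clm_apply ((h'.clm_apply cv).clm_apply cu))) a
  simp at this
  rw [← this]
  abel

theorem symm_phi (a b : E) : fderiv ℝ (fderiv ℝ φ) x a b = fderiv ℝ (fderiv ℝ φ) x b a :=
  (H.smooth_phi x hx).isSymmSndFDerivAt (by simpa using two_le_infty) a b

theorem symm_eta (a b : E) : fderiv ℝ (fderiv ℝ η) x a b = fderiv ℝ (fderiv ℝ η) x b a :=
  (H.smooth_eta x hx).isSymmSndFDerivAt (by simpa using two_le_infty) a b

theorem symm_xi (a b : E) : fderiv ℝ (fderiv ℝ ξ) x a b = fderiv ℝ (fderiv ℝ ξ) x b a :=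
  (H.smooth_xi x hx).isSymmSndFDerivAt (by simpa using two_le_infty) a b

omit hx
variable {p : E × E} (hp : p.1 ∈ U)
include hp

theorem eta_vert_phi (v : E × E) :
    flatFormVerticalLift η p (flatEndoCompleteLift φ p v) = 0 :=
  H.eta_phi _ hp _

theorem eta_compl_phi (v : E × E) :
    flatFormCompleteLift η p (flatEndoCompleteLift φ p v) = 0 := by
  simp [flatFormCompleteLift, flatEndoCompleteLift, H.eta_phi _ hp, H.fderiv_eta_phi hp]

theorem phi_xi_vert : flatEndoCompleteLift φ p (flatVectorVerticalLift ξ p) = 0 := by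
  simp [flatEndoCompleteLift, flatVectorVerticalLift, H.phi_xi _ hp]

theorem phi_xi_compl : flatEndoCompleteLift φ p (flatVectorCompleteLift ξ p) = 0 := by
  simp [flatEndoCompleteLift, flatVectorCompleteLift, H.phi_xi _ hp, H.fderiv_phi_xi hp]

omit H hp in
theorem eta_vert_xi_vert : flatFormVerticalLift η p (flatVectorVerticalLift ξ p) = 0 := by
  simp [flatFormVerticalLift, flatVectorVerticalLift]

theorem eta_vert_xi_compl : flatFormVerticalLift η p (flatVectorCompleteLift ξ p) = 1 := by
  simp [flatFormVerticalLift, flatVectorCompleteLift, H.eta_xi _ hp]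

theorem eta_compl_xi_vert : flatFormCompleteLift η p (flatVectorVerticalLift ξ p) = 1 := by
  simp [flatFormCompleteLift, flatVectorVerticalLift, H.eta_xi _ hp]

theorem eta_compl_xi_compl : flatFormCompleteLift η p (flatVectorCompleteLift ξ p) = 0 := by
  simp [flatFormCompleteLift, flatVectorCompleteLift, H.fderiv_eta_xi hp]

/-- The complete lift is multiplicative, and the complete lift of η ⊗ ξ is η^v ⊗ ξ^c + η^c ⊗ ξ^v. In
the second component this is the identity φ² = I - η ⊗ ξ differentiated along the fibre coordinate.
-/
theorem phi_phi_compl (v : E × E) : flatEndoCompleteLift φ p (flatEndoCompleteLift φ p v)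
    = v - flatFormVerticalLift η p v • flatVectorCompleteLift ξ p
      - flatFormCompleteLift η p v • flatVectorVerticalLift ξ p := by
  have h := H.fderiv_phi_phi hp p.2 v.1
  refine Prod.ext ?_ ?_
  · simp [flatEndoCompleteLift, flatFormVerticalLift, flatVectorCompleteLift,
      flatVectorVerticalLift, H.phi_phi _ hp]
  · simp only [flatEndoCompleteLift, flatFormVerticalLift, flatVectorCompleteLift,
      flatFormCompleteLift, flatVectorVerticalLift, H.phi_phi _ hp, add_apply,
      ContinuousLinearMap.comp_apply, ContinuousLinearMap.prod_apply, ContinuousLinearMap.coe_fst',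
      ContinuousLinearMap.coe_snd', map_add, Prod.snd_sub, Prod.smul_snd]
    linear_combination (norm := module) h

/-- The cross terms vanish because φ^c kills both lifts of ξ and both lifts of η kill the image of
φ^c. The square of η^v ⊗ ξ^v + η^c ⊗ ξ^c is η^c ⊗ ξ^v + η^v ⊗ ξ^c, which is what (φ^c)² lacks. -/
theorem flatProductLift_flatProductLift (v : E × E) :
    flatProductLift φ η ξ p (flatProductLift φ η ξ p v) = v := by
  simp only [flatProductLift, add_apply, ContinuousLinearMap.smulRight_apply, map_add, map_smul,
    H.eta_vert_phi hp, H.eta_compl_phi hp, H.phi_xi_vert hp, H.phi_xi_compl hp, eta_vert_xi_vert,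
    H.eta_vert_xi_compl hp, H.eta_compl_xi_vert hp, H.eta_compl_xi_compl hp, H.phi_phi_compl hp]
  module

omit hp

theorem isOpen_preimage : IsOpen (Prod.fst ⁻¹' U : Set (E × E)) := H.isOpen.preimage continuous_fst

include hx

/-- The Nijenhuis tensor of φ^c is the complete lift of that of φ: its first component is N_φ(a, c),
its second N_φ(b, c) + N_φ(a, d) plus the derivative of N_φ along y at (a, c). -/
theorem flatNijenhuis_flatEndoCompleteLift (y : E) (u v : E × E) :
    flatNijenhuis (flatEndoCompleteLift φ) (x, y) u v = 0 := by
  obtain ⟨a, b⟩ := u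
  obtain ⟨c, d⟩ := v
  have app : ∀ c d : E, flatEndoCompleteLift φ (x, y) (c, d)
      = (φ x c, fderiv ℝ φ x y c + φ x d) := fun _ _ => rfl
  have h1 := H.normal x hx a c
  have h2 := H.normal x hx b c
  have h3 := H.normal x hx a d
  have h4 := H.fderiv_normal hx y a c
  simp only [flatNijenhuis] at h1 h2 h3 ⊢
  simp only [app, fderiv_flatEndoCompleteLift (H.smooth_phi x hx)]
  refine Prod.ext h1 ?_
  -- Differentiating N_φ along y puts y in the outer slot of D²φ, whereas the derivative of the lift
  -- has it in the inner slot.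
  simp only [H.symm_phi hx y] at h4
  simp only [Prod.snd_add, Prod.snd_sub, map_add, add_apply, Prod.snd_zero]
  linear_combination (norm := module) h2 + h3 + h4

theorem flatFormVerticalLift_closed (y : E) (u v : E × E) :
    fderiv ℝ (flatFormVerticalLift η) (x, y) u v = fderiv ℝ (flatFormVerticalLift η) (x, y) v u := by
  obtain ⟨a, b⟩ := u
  obtain ⟨c, d⟩ := v
  rw [fderiv_flatFormVerticalLift (H.smooth_eta x hx), H.closed x hx a,
    fderiv_flatFormVerticalLift (H.smooth_eta x hx)]

/-- The terms with Dη are symmetric because η is closed; the term with D²η is symmetric by Schwarz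
together with the derivative of the closedness relation along y. -/
theorem flatFormCompleteLift_closed (y : E) (u v : E × E) :
    fderiv ℝ (flatFormCompleteLift η) (x, y) u v = fderiv ℝ (flatFormCompleteLift η) (x, y) v u := by
  obtain ⟨a, b⟩ := u
  obtain ⟨c, d⟩ := v
  rw [fderiv_flatFormCompleteLift (H.smooth_eta x hx), fderiv_flatFormCompleteLift
    (H.smooth_eta x hx), H.closed x hx b, H.closed x hx a, H.symm_eta hx a, H.symm_eta hx c,
    H.fderiv_closed hx y a c]
  ring

/-- The Lie derivative of φ^c along ξ^v is the vertical lift of L_ξ φ, hence zero. -/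
theorem flatVectorVerticalLift_invariant (y : E) (v : E × E) :
    fderiv ℝ (flatEndoCompleteLift φ) (x, y) (flatVectorVerticalLift ξ (x, y)) v
      - fderiv ℝ (flatVectorVerticalLift ξ) (x, y) (flatEndoCompleteLift φ (x, y) v)
      + flatEndoCompleteLift φ (x, y) (fderiv ℝ (flatVectorVerticalLift ξ) (x, y) v) = 0 := by
  obtain ⟨c, d⟩ := v
  have app : ∀ c d : E, flatEndoCompleteLift φ (x, y) (c, d)
    = (φ x c, fderiv ℝ φ x y c + φ x d) := fun _ _ => rfl
  have hv : flatVectorVerticalLift ξ (x, y) = (0, ξ x) := rfl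
  have h := H.invariant x hx c
  rw [hv, app, fderiv_flatEndoCompleteLift (H.smooth_phi x hx),
    fderiv_flatVectorVerticalLift (H.smooth_xi x hx),
    fderiv_flatVectorVerticalLift (H.smooth_xi x hx), app]
  rw [(fderiv ℝ (fderiv ℝ φ) x).map_zero, (fderiv ℝ φ x).map_zero, (φ x).map_zero,
    (fderiv ℝ φ x y).map_zero]
  refine Prod.ext ?_ ?_
  · simp only [Prod.fst_add, Prod.fst_sub, Prod.fst_zero, zero_apply, sub_zero, add_zero]
  · simp only [Prod.snd_add, Prod.snd_sub, Prod.snd_zero, zero_apply, zero_add, add_zero]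
    exact h

/-- The Lie derivative of φ^c along ξ^c is the complete lift of L_ξ φ: its second component combines
L_ξ φ with its derivative along y. -/
theorem flatVectorCompleteLift_invariant (y : E) (v : E × E) :
    fderiv ℝ (flatEndoCompleteLift φ) (x, y) (flatVectorCompleteLift ξ (x, y)) v
      - fderiv ℝ (flatVectorCompleteLift ξ) (x, y) (flatEndoCompleteLift φ (x, y) v)
      + flatEndoCompleteLift φ (x, y) (fderiv ℝ (flatVectorCompleteLift ξ) (x, y) v) = 0 := by
  obtain ⟨c, d⟩ := v
  have app : ∀ c d : E, flatEndoCompleteLift φ (x, y) (c, d)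
    = (φ x c, fderiv ℝ φ x y c + φ x d) := fun _ _ => rfl
  have hv : flatVectorCompleteLift ξ (x, y) = (ξ x, fderiv ℝ ξ x y) := rfl
  have h := H.invariant x hx c
  have h' := H.invariant x hx d
  have h2 := H.fderiv_invariant hx y c
  rw [hv, app, fderiv_flatEndoCompleteLift (H.smooth_phi x hx),
    fderiv_flatVectorCompleteLift (H.smooth_xi x hx),
    fderiv_flatVectorCompleteLift (H.smooth_xi x hx), app]
  refine Prod.ext h ?_
  rw [H.symm_phi hx y, H.symm_xi hx y, H.symm_xi hx y] at h2
  simp only [Prod.snd_add, Prod.snd_sub, map_add, Prod.snd_zero]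
  linear_combination (norm := module) h' + h2

/-- This is [ξ^v, ξ^c] = [ξ, ξ]^v = 0. -/
theorem flatVectorLifts_commute (y : E) :
    fderiv ℝ (flatVectorCompleteLift ξ) (x, y) (flatVectorVerticalLift ξ (x, y))
      = fderiv ℝ (flatVectorVerticalLift ξ) (x, y) (flatVectorCompleteLift ξ (x, y)) := by
  have h1 : flatVectorVerticalLift ξ (x, y) = (0, ξ x) := rfl
  have h2 : flatVectorCompleteLift ξ (x, y) = (ξ x, fderiv ℝ ξ x y) := rfl
  rw [h1, h2, fderiv_flatVectorCompleteLift (H.smooth_xi x hx),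
    fderiv_flatVectorVerticalLift (H.smooth_xi x hx)]
  simp

theorem flatNijenhuis_flatProductLift (y : E) (u v : E × E) :
    flatNijenhuis (flatProductLift φ η ξ) (x, y) u v = 0 := by
  have sφ := contDiffAt_flatEndoCompleteLift (p := (x, y)) (H.smooth_phi x hx)
  have sα := contDiffAt_flatFormVerticalLift (p := (x, y)) (H.smooth_eta x hx)
  have sβ := contDiffAt_flatFormCompleteLift (p := (x, y)) (H.smooth_eta x hx)
  have sA := contDiffAt_flatVectorVerticalLift (p := (x, y)) (H.smooth_xi x hx)
  have sB := contDiffAt_flatVectorCompleteLift (p := (x, y)) (H.smooth_xi x hx)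
  have dφ := sφ.differentiableAt (by simp)
  have dα := sα.differentiableAt (by simp)
  have dβ := sβ.differentiableAt (by simp)
  have dA := sA.differentiableAt (by simp)
  have dB := sB.differentiableAt (by simp)
  have hO := H.isOpen_preimage
  have hp : (x, y) ∈ (Prod.fst ⁻¹' U : Set (E × E)) := hx
  -- Differentiates a constant pairing of a form with a field; `kil` does the same for a form that
  -- annihilates the image of φ^c.
  have cst : ∀ {γ : E × E → E × E →L[ℝ] ℝ} {C : E × E → E × E} {k : ℝ},
      DifferentiableAt ℝ γ (x, y) → DifferentiableAt ℝ C (x, y) →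
      (∀ p ∈ (Prod.fst ⁻¹' U : Set (E × E)), γ p (C p) = k) → ∀ u,
      fderiv ℝ γ (x, y) u (C (x, y)) + γ (x, y) (fderiv ℝ C (x, y) u) = 0 := by
    intro γ C k dγ dC h u
    simpa [add_comm] using
      eq_zero_of_hasFDerivAt_of_const hO hp h (dγ.hasFDerivAt.clm_apply dC.hasFDerivAt) u
  have kil : ∀ {γ : E × E → E × E →L[ℝ] ℝ}, DifferentiableAt ℝ γ (x, y) →
      (∀ p ∈ (Prod.fst ⁻¹' U : Set (E × E)), ∀ v, γ p (flatEndoCompleteLift φ p v) = 0) → ∀ u v,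
      fderiv ℝ γ (x, y) u (flatEndoCompleteLift φ (x, y) v)
        + γ (x, y) (fderiv ℝ (flatEndoCompleteLift φ) (x, y) u v) = 0 := by
    intro γ dγ h u v
    simpa [add_comm] using eq_zero_of_hasFDerivAt_of_const hO hp (fun p hp => h p hp v)
      (dγ.hasFDerivAt.clm_apply (dφ.hasFDerivAt.clm_apply (hasFDerivAt_const v _))) u
  refine flatNijenhuis_add_smulRight_eq_zero dφ dα dβ dA dB
    (H.flatNijenhuis_flatEndoCompleteLift hx y) (H.flatFormVerticalLift_closed hx y)
    (H.flatFormCompleteLift_closed hx y) (H.phi_xi_vert hx) (H.phi_xi_compl hx)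
    (kil dα fun p hp => H.eta_vert_phi hp) (kil dβ fun p hp => H.eta_compl_phi hp)
    (H.flatVectorVerticalLift_invariant hx y) (H.flatVectorCompleteLift_invariant hx y)
    (cst dα dA fun p hp => eta_vert_xi_vert) (cst dα dB fun p hp => H.eta_vert_xi_compl hp)
    (cst dβ dA fun p hp => H.eta_compl_xi_vert hp) (cst dβ dB fun p hp => H.eta_compl_xi_compl hp)
    (H.flatVectorLifts_commute hx y) u v

end IsFlatNormalParacontact

end FlatNormal

/-! ### Fields, derivatives and Lie brackets in a chart -/

section Coordinates

variable {E : Type*} [NormedAddCommGroup E] [NormedSpace ℝ E]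
  {H : Type*} [TopologicalSpace H] {I : ModelWithCorners ℝ E H}
  {M : Type*} [TopologicalSpace M] [ChartedSpace H M] [IsManifold I ∞ M]

theorem mlieBracket_eq_lieBracket
    {V W : ∀ x : E, TangentSpace 𝓘(ℝ, E) x} :
    mlieBracket 𝓘(ℝ, E) V W = lieBracket ℝ V W := by
  rw [← mlieBracketWithin_univ, mlieBracketWithin_eq_lieBracketWithin]
  exact lieBracketWithin_univ

theorem contMDiffAt_vectorFieldRep_iff {X : ∀ x : M, TangentSpace I x} {x₀ x : M}
    (hx : x ∈ (chartAt H x₀).source) :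
    ContMDiffAt I I.tangent ∞ (fun x => (⟨x, X x⟩ : TangentBundle I M)) x ↔
      ContMDiffAt I 𝓘(ℝ, E) ∞ (vectorFieldRep I X x₀) x := by
  rw [(trivializationAt E (TangentSpace I) x₀).contMDiffAt_section_iff (IB := I) hx]
  refine Filter.EventuallyEq.contMDiffAt_iff ?_
  filter_upwards [(chartAt H x₀).open_source.mem_nhds hx] with z hz
  rw [vectorFieldRep, Trivialization.continuousLinearMapAt_apply_of_mem _ _ hz]

theorem contMDiffAt_oneFormRep {α : ∀ x : M, TangentSpace I x →L[ℝ] ℝ} (h : IsSmoothOneForm I α)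
    {x₀ x : M} (hx : x ∈ (chartAt H x₀).source) :
    ContMDiffAt I 𝓘(ℝ, E →L[ℝ] ℝ) ∞ (oneFormRep I α x₀) x := by
  have := ((trivializationAt (E →L[ℝ] ℝ)
    (fun x : M => TangentSpace I x →L[ℝ] Bundle.Trivial M ℝ x) x₀).contMDiffAt_section_iff
    (IB := I) (n := ∞) (s := α) (x₀ := x) (by simpa using hx)).1 (h x)
  convert! this using 2
  ext v
  change _ = ContinuousLinearMap.inCoordinates E (TangentSpace I) ℝ (Bundle.Trivial M ℝ) x₀ _ x₀ _
    (α _) v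
  simp [oneFormRep, ContinuousLinearMap.inCoordinates]

theorem contMDiffAt_endoFieldRep_iff {F : ∀ x : M, TangentSpace I x →L[ℝ] TangentSpace I x}
    {x₀ x : M} (hx : x ∈ (chartAt H x₀).source) :
    ContMDiffAt I (I.prod 𝓘(ℝ, E →L[ℝ] E)) ∞ (fun x => TotalSpace.mk' (E →L[ℝ] E)
      (E := fun x : M => TangentSpace I x →L[ℝ] TangentSpace I x) x (F x)) x ↔
    ContMDiffAt I 𝓘(ℝ, E →L[ℝ] E) ∞ (endoFieldRep I F x₀) x :=
  (trivializationAt (E →L[ℝ] E)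
    (fun x : M => TangentSpace I x →L[ℝ] TangentSpace I x) x₀).contMDiffAt_section_iff
    (IB := I) (n := ∞) (s := F) (x₀ := x) (by simpa using hx)

variable {G : Type*} [NormedAddCommGroup G] [NormedSpace ℝ G]

section Boundaryless

variable [I.Boundaryless]

theorem contDiffAt_comp_extChartAt_symm {f : M → G} {x₀ x : M} (hx : x ∈ (chartAt H x₀).source)
    (hf : ContMDiffAt I 𝓘(ℝ, G) ∞ f x) :
    ContDiffAt ℝ ∞ (f ∘ (extChartAt I x₀).symm) (extChartAt I x₀ x) := by
  have hx' : x ∈ (extChartAt I x₀).source := by rwa [extChartAt_source]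
  have h1 : ContMDiffAt 𝓘(ℝ, E) I ∞ (extChartAt I x₀).symm (extChartAt I x₀ x) :=
    (contMDiffOn_extChartAt_symm x₀).contMDiffAt
      (extChartAt_target_mem_nhds' ((extChartAt I x₀).map_source hx'))
  rw [← contMDiffAt_iff_contDiffAt]
  refine ContMDiffAt.comp _ ?_ h1
  rwa [(extChartAt I x₀).left_inv hx']

theorem mdifferentiableAt_comp_extChartAt_symm {f : M → G} {x₀ x : M}
    (hx : x ∈ (chartAt H x₀).source) (hf : MDifferentiableAt I 𝓘(ℝ, G) f x) :
    DifferentiableAt ℝ (f ∘ (extChartAt I x₀).symm) (extChartAt I x₀ x) := by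
  have hx' : x ∈ (extChartAt I x₀).source := by rwa [extChartAt_source]
  have h1 : MDifferentiableAt 𝓘(ℝ, E) I (extChartAt I x₀).symm (extChartAt I x₀ x) :=
    ((contMDiffOn_extChartAt_symm (n := ∞) x₀).contMDiffAt
      (extChartAt_target_mem_nhds' ((extChartAt I x₀).map_source hx'))).mdifferentiableAt (by simp)
  rw [← mdifferentiableAt_iff_differentiableAt]
  refine MDifferentiableAt.comp _ ?_ h1
  rwa [(extChartAt I x₀).left_inv hx']

omit [IsManifold I ∞ M] [NormedAddCommGroup G] [NormedSpace ℝ G] [I.Boundaryless] in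
theorem eventually_extChartAt_symm_comp {f : M → G} {x₀ x : M} (hx : x ∈ (chartAt H x₀).source) :
    f =ᶠ[nhds x] (f ∘ (extChartAt I x₀).symm) ∘ extChartAt I x₀ := by
  filter_upwards [(chartAt H x₀).open_source.mem_nhds hx] with z hz
  simp only [Function.comp_apply]
  rw [(extChartAt I x₀).left_inv (by rwa [extChartAt_source])]

/-- Chain rule: near x, f factors through the chart, whose derivative is the tangent bundle
trivialization. -/
theorem mvfderiv_eq_fderiv_comp_extChartAt_symm {f : M → G} {x₀ x : M}
    (hx : x ∈ (chartAt H x₀).source) (hf : MDifferentiableAt I 𝓘(ℝ, G) f x)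
    (y : TangentSpace I x) :
    mvfderiv I f x y = fderiv ℝ (f ∘ (extChartAt I x₀).symm) (extChartAt I x₀ x)
      ((trivializationAt E (TangentSpace I) x₀).continuousLinearMapAt ℝ x y) := by
  have h1 := (mdifferentiableAt_comp_extChartAt_symm hx hf).hasFDerivAt.hasMFDerivAt
  have h2 := (mdifferentiableAt_extChartAt (I := I) hx).hasMFDerivAt
  have h3 := (h1.comp x h2).congr_of_eventuallyEq (eventually_extChartAt_symm_comp (I := I) hx)
  rw [TangentBundle.continuousLinearMapAt_trivializationAt hx]
  exact congrArg (fun L : E →L[ℝ] G => L y) h3.mfderiv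

/-- Near x every field is the pullback of its components under the chart, and the Lie bracket is
natural under pullback. -/
theorem continuousLinearMapAt_mlieBracket [CompleteSpace E] {X Y : ∀ x : M, TangentSpace I x}
    {x₀ x : M} (hx : x ∈ (chartAt H x₀).source)
    (hX : ContMDiffAt I 𝓘(ℝ, E) ∞ (vectorFieldRep I X x₀) x)
    (hY : ContMDiffAt I 𝓘(ℝ, E) ∞ (vectorFieldRep I Y x₀) x) :
    (trivializationAt E (TangentSpace I) x₀).continuousLinearMapAt ℝ x (mlieBracket I X Y x)
      = lieBracket ℝ (vectorFieldRep I X x₀ ∘ (extChartAt I x₀).symm)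
        (vectorFieldRep I Y x₀ ∘ (extChartAt I x₀).symm) (extChartAt I x₀ x) := by
  have pull : ∀ Z : ∀ x : M, TangentSpace I x,
      Z =ᶠ[nhds x] mpullback I 𝓘(ℝ, E) (extChartAt I x₀)
        (vectorFieldRep I Z x₀ ∘ (extChartAt I x₀).symm) := by
    intro Z
    filter_upwards [(chartAt H x₀).open_source.mem_nhds hx] with z hz
    have hz' : z ∈ (extChartAt I x₀).source := by rwa [extChartAt_source]
    refine ((isInvertible_mfderiv_extChartAt hz').inverse_apply_eq.2 ?_).symm
    rw [Function.comp_apply, (extChartAt I x₀).left_inv hz', vectorFieldRep,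
      TangentBundle.continuousLinearMapAt_trivializationAt hz]
    rfl
  have sect : ∀ {Z : ∀ x : M, TangentSpace I x},
      ContMDiffAt I 𝓘(ℝ, E) ∞ (vectorFieldRep I Z x₀) x →
      MDifferentiableAt 𝓘(ℝ, E) 𝓘(ℝ, E).tangent (fun u : E =>
        (⟨u, (vectorFieldRep I Z x₀ ∘ (extChartAt I x₀).symm) u⟩ : TangentBundle 𝓘(ℝ, E) E))
        (extChartAt I x₀ x) := by
    intro Z hZ
    exact (contMDiffAt_vectorSpace_iff_contDiffAt.2
      (contDiffAt_comp_extChartAt_symm hx hZ)).mdifferentiableAt (by simp)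
  have : IsManifold I (minSmoothness ℝ 2) M :=
    IsManifold.of_le (n := ∞) (by simpa using two_le_infty)
  rw [(pull X).mlieBracket_vectorField_eq (pull Y),
    ← mpullback_mlieBracket (n := ∞) (sect hX) (sect hY)
      ((contMDiffOn_extChartAt (n := ∞)).contMDiffAt ((chartAt H x₀).open_source.mem_nhds hx))
      (by simpa using two_le_infty), mpullback_apply,
    TangentBundle.continuousLinearMapAt_trivializationAt hx]
  have hx' : x ∈ (extChartAt I x₀).source := by rwa [extChartAt_source]
  refine ((isInvertible_mfderiv_extChartAt (I := I) hx').self_apply_inverse _).trans ?_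
  exact congrFun mlieBracket_eq_lieBracket (extChartAt I x₀ x)

end Boundaryless

end Coordinates

/-! ### Change of chart on the tangent bundle and chart independence of the lifts -/

section TangentCoordinates

variable {E : Type*} [NormedAddCommGroup E] [NormedSpace ℝ E]
  {H : Type*} [TopologicalSpace H] {I : ModelWithCorners ℝ E H}
  {M : Type*} [TopologicalSpace M] [ChartedSpace H M] [IsManifold I ∞ M]
  {G : Type*} [NormedAddCommGroup G] [NormedSpace ℝ G]

variable (I) in
/-- The coordinate change of the tangent bundle, from the preferred chart at `x` to the preferred
chart at `x₀`. -/
def chartChange (x₀ x z : M) : E →L[ℝ] E :=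
  ((trivializationAt E (TangentSpace I) x₀).continuousLinearMapAt ℝ z).comp
    ((trivializationAt E (TangentSpace I) x).symmL ℝ z)

theorem chartChange_self (x₀ x : M) : chartChange I x₀ x x
    = (trivializationAt E (TangentSpace I) x₀).continuousLinearMapAt ℝ x := by
  rw [chartChange, trivializationAt_symmL_self]
  rfl

theorem chartChange_continuousLinearMapAt {x₀ x z : M} (hz : z ∈ (chartAt H x).source)
    (w : TangentSpace I z) :
    chartChange I x₀ x z ((trivializationAt E (TangentSpace I) x).continuousLinearMapAt ℝ z w)
      = (trivializationAt E (TangentSpace I) x₀).continuousLinearMapAt ℝ z w := by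
  rw [chartChange, ContinuousLinearMap.comp_apply, Trivialization.symmL_continuousLinearMapAt _ hz]

section Boundaryless

variable [I.Boundaryless]

theorem contDiffAt_chartTransition {x₀ x : M} (hx : x ∈ (chartAt H x₀).source) :
    ContDiffAt ℝ ∞ (extChartAt I x₀ ∘ (extChartAt I x).symm) (extChartAt I x x) :=
  contDiffAt_comp_extChartAt_symm (mem_chart_source H x)
    ((contMDiffOn_extChartAt (n := ∞)).contMDiffAt ((chartAt H x₀).open_source.mem_nhds hx))

theorem chartChange_eq_fderiv {x₀ x z : M} (hz₀ : z ∈ (chartAt H x₀).source)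
    (hz : z ∈ (chartAt H x).source) :
    chartChange I x₀ x z
      = fderiv ℝ (extChartAt I x₀ ∘ (extChartAt I x).symm) (extChartAt I x z) := by
  have h := tangentCoordChange_def (I := I) (x := x) (y := x₀) (z := z)
  rw [I.range_eq_univ, fderivWithin_univ] at h
  rw [← h, chartChange, TangentBundle.continuousLinearMapAt_trivializationAt_eq_core hz₀,
    TangentBundle.symmL_trivializationAt_eq_core hz]
  ext v
  exact (tangentBundleCore I M).coordChange_comp _ _ _ _
    ⟨⟨hz, mem_chart_source H z⟩, hz₀⟩ v

theorem eventually_chartChange_eq_fderiv {x₀ x : M} (hx : x ∈ (chartAt H x₀).source) :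
    chartChange I x₀ x =ᶠ[nhds x] fun z =>
      fderiv ℝ (extChartAt I x₀ ∘ (extChartAt I x).symm) (extChartAt I x z) := by
  filter_upwards [(chartAt H x₀).open_source.mem_nhds hx,
    (chartAt H x).open_source.mem_nhds (mem_chart_source H x)] with z h1 h2
  exact chartChange_eq_fderiv h1 h2

theorem contMDiffAt_chartChange {x₀ x : M} (hx : x ∈ (chartAt H x₀).source) :
    ContMDiffAt I 𝓘(ℝ, E →L[ℝ] E) ∞ (chartChange I x₀ x) x := by
  refine ContMDiffAt.congr_of_eventuallyEq ?_ (eventually_chartChange_eq_fderiv hx)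
  exact (((contDiffAt_chartTransition hx).fderiv_right (m := ∞) (by simp)).contMDiffAt).comp x
    contMDiffAt_extChartAt

theorem mdifferentiableAt_chartChange {x₀ x : M} (hx : x ∈ (chartAt H x₀).source) :
    MDifferentiableAt I 𝓘(ℝ, E →L[ℝ] E) (chartChange I x₀ x) x :=
  (contMDiffAt_chartChange hx).mdifferentiableAt (by simp)

/-- The Jacobian of the transition map is being differentiated, so this is the symmetry of a second
derivative. It is what makes the complete lifts independent of the chart. -/
theorem mvfderiv_chartChange_symm {x₀ x : M} (hx : x ∈ (chartAt H x₀).source)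
    (a b : E) :
    mvfderiv I (chartChange I x₀ x) x a b = mvfderiv I (chartChange I x₀ x) x b a := by
  have key : ∀ a : TangentSpace I x, mvfderiv I (chartChange I x₀ x) x a
      = fderiv ℝ (fderiv ℝ (extChartAt I x₀ ∘ (extChartAt I x).symm)) (extChartAt I x x) a := by
    intro a
    rw [mvfderiv_eq_fderiv_comp_extChartAt_symm (mem_chart_source H x)
      (mdifferentiableAt_chartChange hx), trivializationAt_clmAt_self]
    have e : chartChange I x₀ x ∘ (extChartAt I x).symm =ᶠ[nhds (extChartAt I x x)]
        fderiv ℝ (extChartAt I x₀ ∘ (extChartAt I x).symm) := by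
      have h1 := (continuousAt_extChartAt_symm (I := I) x).eventually
        (p := fun z => chartChange I x₀ x z
          = fderiv ℝ (extChartAt I x₀ ∘ (extChartAt I x).symm) (extChartAt I x z))
        (by rw [extChartAt_to_inv]; exact eventually_chartChange_eq_fderiv hx)
      filter_upwards [h1, extChartAt_target_mem_nhds (I := I) x] with u h1 h2
      rw [Function.comp_apply, h1, (extChartAt I x).right_inv h2]
    rw [e.fderiv_eq]
    rfl
  exact (congrArg (fun L : E →L[ℝ] E => L b) (key a)).trans
    (((contDiffAt_chartTransition hx).isSymmSndFDerivAt (by simpa using two_le_infty) a b).trans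
    (congrArg (fun L : E →L[ℝ] E => L a) (key b)).symm)

theorem hasMFDerivAt_clm_apply {E' : Type*} [NormedAddCommGroup E'] [NormedSpace ℝ E']
    {H' : Type*} [TopologicalSpace H'] {I' : ModelWithCorners ℝ E' H'}
    {N : Type*} [TopologicalSpace N] [ChartedSpace H' N]
    {F₁ F₂ : Type*} [NormedAddCommGroup F₁] [NormedSpace ℝ F₁] [NormedAddCommGroup F₂]
    [NormedSpace ℝ F₂] {g : N → F₁ →L[ℝ] F₂} {f : N → F₁} {x : N}
    {g' : E' →L[ℝ] F₁ →L[ℝ] F₂} {f' : E' →L[ℝ] F₁}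
    (hg : HasMFDerivAt I' 𝓘(ℝ, F₁ →L[ℝ] F₂) g x g') (hf : HasMFDerivAt I' 𝓘(ℝ, F₁) f x f') :
    HasMFDerivAt I' 𝓘(ℝ, F₂) (fun z => g z (f z)) x ((g x).comp f' + g'.flip (f x)) := by
  refine ⟨(hg.mdifferentiableAt.clm_apply hf.mdifferentiableAt).continuousAt, ?_⟩
  have := HasFDerivWithinAt.clm_apply hg.2 hf.2
  simpa [writtenInExtChartAt] using! this

omit [I.Boundaryless] in
theorem continuous_proj_tangentBundle :
    Continuous (TotalSpace.proj : TangentBundle I M → M) :=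
  FiberBundle.continuous_proj E (TangentSpace I : M → Type _)

omit [I.Boundaryless] in
theorem trivializationAt_snd_eq {x₀ : M} {w : TangentBundle I M}
    (hw : w.proj ∈ (chartAt H x₀).source) : (trivializationAt E (TangentSpace I) x₀ w).2
      = (trivializationAt E (TangentSpace I) x₀).continuousLinearMapAt ℝ w.proj w.snd := by
  rw [Trivialization.continuousLinearMapAt_apply_of_mem _ _
    (show w.proj ∈ (trivializationAt E (TangentSpace I) x₀).baseSet from hw)]

omit [I.Boundaryless] in
theorem extChartAt_tangent_apply (v₀ w : TangentBundle I M) : extChartAt I.tangent v₀ w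
    = (extChartAt I v₀.proj w.proj, (trivializationAt E (TangentSpace I) v₀.proj w).2) := rfl

/-- The induced charts of TM are related by (x, y) ↦ (τ(x), Dτ(x) y), with τ the transition map of
M. Its derivative at (a, b) is (Dτ a, D²τ(a) y + Dτ b). -/
theorem continuousLinearMapAt_tangent_trivializationAt {v₀ v : TangentBundle I M}
    (hv : v.proj ∈ (chartAt H v₀.proj).source) (a b : E) :
    (trivializationAt (E × E) (TangentSpace I.tangent) v₀).continuousLinearMapAt ℝ v (a, b)
      = (chartChange I v₀.proj v.proj v.proj a,
        mvfderiv I (chartChange I v₀.proj v.proj) v.proj a v.snd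
          + chartChange I v₀.proj v.proj v.proj b) := by
  have hv' : v ∈ (chartAt (ModelProd H E) v₀).source := by simpa using hv
  rw [TangentBundle.continuousLinearMapAt_trivializationAt hv']
  have h1 := ((mdifferentiableAt_extChartAt (I := I) hv).hasMFDerivAt).comp v
    (hasMFDerivAt_tangentBundle_proj v)
  have h2 := hasMFDerivAt_clm_apply
    (((mdifferentiableAt_chartChange hv).hasMFDerivAt).comp v (hasMFDerivAt_tangentBundle_proj v))
    (hasMFDerivAt_tangentBundle_fiberCoord v)
  have h3 : HasMFDerivAt I.tangent 𝓘(ℝ, E × E) (fun w : TangentBundle I M =>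
      (extChartAt I v₀.proj w.proj,
        chartChange I v₀.proj v.proj w.proj (trivializationAt E (TangentSpace I) v.proj w).2)) v _ :=
    ⟨h1.1.prodMk h2.1, h1.2.prodMk h2.2⟩
  have e : extChartAt I.tangent v₀ =ᶠ[nhds v] fun w : TangentBundle I M =>
      (extChartAt I v₀.proj w.proj,
        chartChange I v₀.proj v.proj w.proj (trivializationAt E (TangentSpace I) v.proj w).2) := by
    filter_upwards [(continuous_proj_tangentBundle (I := I) (M := M)).continuousAt.preimage_mem_nhds
      ((chartAt H v.proj).open_source.mem_nhds (mem_chart_source H v.proj)),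
      (continuous_proj_tangentBundle (I := I) (M := M)).continuousAt.preimage_mem_nhds
      ((chartAt H v₀.proj).open_source.mem_nhds hv)] with w hw hw₀
    rw [trivializationAt_snd_eq hw, chartChange_continuousLinearMapAt hw,
      extChartAt_tangent_apply, trivializationAt_snd_eq hw₀]
  have h4 := h3.congr_of_eventuallyEq e
  rw [h4.mfderiv]
  refine Prod.ext ?_ ?_
  · rw [chartChange_self, TangentBundle.continuousLinearMapAt_trivializationAt hv]
    rfl
  · have e2 : (trivializationAt E (TangentSpace I) v.proj v).2 = v.snd := by
      rw [trivializationAt_snd_eq (mem_chart_source H v.proj), trivializationAt_clmAt_self]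
      rfl
    rw [add_comm, ← e2]
    rfl

omit [I.Boundaryless] in
theorem extChartAt_tangent_eq {v₀ v : TangentBundle I M}
    (hv : v.proj ∈ (chartAt H v₀.proj).source) : extChartAt I.tangent v₀ v
      = (extChartAt I v₀.proj v.proj, chartChange I v₀.proj v.proj v.proj v.snd) := by
  rw [extChartAt_tangent_apply, trivializationAt_snd_eq hv, chartChange_self]
  rfl

omit [I.Boundaryless] in
theorem mvfderiv_clm_apply_const {F₁ F₂ : Type*} [NormedAddCommGroup F₁] [NormedSpace ℝ F₁]
    [NormedAddCommGroup F₂] [NormedSpace ℝ F₂] {g : M → F₁ →L[ℝ] F₂} {x : M}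
    (hg : MDifferentiableAt I 𝓘(ℝ, F₁ →L[ℝ] F₂) g x) (w : F₁) (y : TangentSpace I x) :
    mvfderiv I (fun z => g z w) x y = mvfderiv I g x y w := by
  have h0 : mvfderiv I (fun _ : M => w) x y = 0 := by
    rw [mvfderiv_const]
    rfl
  rw [mvfderiv_clm_apply_eq hg mdifferentiableAt_const, h0, map_zero, add_zero]

section Rep

variable {x₀ x : M} (hx : x ∈ (chartAt H x₀).source)
include hx

omit [I.Boundaryless] in
theorem vectorFieldRep_comp_symm (X : ∀ x : M, TangentSpace I x) :
    (vectorFieldRep I X x₀ ∘ (extChartAt I x₀).symm) (extChartAt I x₀ x)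
      = chartChange I x₀ x x (X x) := by
  rw [Function.comp_apply, (extChartAt I x₀).left_inv (by rwa [extChartAt_source]),
    vectorFieldRep, chartChange_self]
  rfl

omit [I.Boundaryless] in
theorem oneFormRep_comp_symm (α : ∀ x : M, TangentSpace I x →L[ℝ] ℝ) (w : E) :
    (oneFormRep I α x₀ ∘ (extChartAt I x₀).symm) (extChartAt I x₀ x) (chartChange I x₀ x x w)
      = α x w := by
  rw [Function.comp_apply, (extChartAt I x₀).left_inv (by rwa [extChartAt_source]),
    oneFormRep, chartChange_self, ContinuousLinearMap.comp_apply]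
  exact congrArg (α x) (Trivialization.symmL_continuousLinearMapAt (R := ℝ) _
    (show x ∈ (trivializationAt E (TangentSpace I) x₀).baseSet from hx) (w : TangentSpace I x))

omit [I.Boundaryless] in
theorem endoFieldRep_comp_symm (F : ∀ x : M, TangentSpace I x →L[ℝ] TangentSpace I x) (w : E) :
    (endoFieldRep I F x₀ ∘ (extChartAt I x₀).symm) (extChartAt I x₀ x) (chartChange I x₀ x x w)
      = chartChange I x₀ x x (F x w) := by
  rw [Function.comp_apply, (extChartAt I x₀).left_inv (by rwa [extChartAt_source]),
    endoFieldRep, chartChange_self, ContinuousLinearMap.comp_apply, ContinuousLinearMap.comp_apply]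
  exact congrArg (fun u : TangentSpace I x =>
      (trivializationAt E (TangentSpace I) x₀).continuousLinearMapAt ℝ x (F x u))
    (Trivialization.symmL_continuousLinearMapAt (R := ℝ) _
    (show x ∈ (trivializationAt E (TangentSpace I) x₀).baseSet from hx) (w : TangentSpace I x))

theorem fderiv_comp_symm_chartChange {f : M → G} (hf : ContMDiffAt I 𝓘(ℝ, G) ∞ f x) (y : E) :
    fderiv ℝ (f ∘ (extChartAt I x₀).symm) (extChartAt I x₀ x) (chartChange I x₀ x x y)
      = mvfderiv I f x y := by
  rw [chartChange_self]
  exact (mvfderiv_eq_fderiv_comp_extChartAt_symm hx (hf.mdifferentiableAt (by simp)) y).symm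

/-- Product rule for X' = A X, where A is the Jacobian of the chart change and the prime marks
components at x₀. The next two results differentiate α = α' A and F' A = A F in the same way. -/
theorem mvfderiv_vectorFieldRep {X : ∀ x : M, TangentSpace I x} (hX : IsSmoothVectorField I X)
    (y : E) : mvfderiv I (vectorFieldRep I X x₀) x y
      = mvfderiv I (chartChange I x₀ x) x y (X x)
        + chartChange I x₀ x x (mvfderiv I (vectorFieldRep I X x) x y) := by
  have e : vectorFieldRep I X x₀ =ᶠ[nhds x] fun z => chartChange I x₀ x z
      (vectorFieldRep I X x z) := by
    filter_upwards [(chartAt H x).open_source.mem_nhds (mem_chart_source H x)] with z hz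
    exact (chartChange_continuousLinearMapAt hz _).symm
  rw [mvfderiv_congr_of_eventuallyEq e]
  refine (mvfderiv_clm_apply_eq (mdifferentiableAt_chartChange hx)
    (mdifferentiableAt_vectorFieldRep hX x) y).trans ?_
  rw [vectorFieldRep_self]

theorem mvfderiv_oneFormRep {α : ∀ x : M, TangentSpace I x →L[ℝ] ℝ} (hα : IsSmoothOneForm I α)
    (y w : E) : mvfderiv I (oneFormRep I α x) x y w
      = mvfderiv I (oneFormRep I α x₀) x y (chartChange I x₀ x x w)
        + oneFormRep I α x₀ x (mvfderiv I (chartChange I x₀ x) x y w) := by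
  have e : (fun z => oneFormRep I α x z w) =ᶠ[nhds x] fun z => oneFormRep I α x₀ z
      (chartChange I x₀ x z w) := by
    filter_upwards [(chartAt H x₀).open_source.mem_nhds hx] with z hz
    simp only [oneFormRep, chartChange, ContinuousLinearMap.comp_apply]
    rw [Trivialization.symmL_continuousLinearMapAt _ hz]
  have hd : MDifferentiableAt I 𝓘(ℝ, E →L[ℝ] ℝ) (oneFormRep I α x₀) x :=
    (contMDiffAt_oneFormRep hα hx).mdifferentiableAt (by simp)
  have hA := mdifferentiableAt_chartChange (I := I) hx
  have hw : MDifferentiableAt I 𝓘(ℝ, E) (fun _ : M => w) x := mdifferentiableAt_const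
  have h1 := mvfderiv_clm_apply_const (mdifferentiableAt_oneFormRep hα x) w y
  have h2 := mvfderiv_clm_apply_eq hd (hA.clm_apply hw) y
  have h3 := mvfderiv_clm_apply_const hA w y
  rw [mvfderiv_congr_of_eventuallyEq e, h2, h3] at h1
  exact h1.symm

theorem mvfderiv_endoFieldRep {F : ∀ x : M, TangentSpace I x →L[ℝ] TangentSpace I x}
    (hF : IsSmoothEndoField I F) (y w : E) :
    mvfderiv I (endoFieldRep I F x₀) x y (chartChange I x₀ x x w)
        + endoFieldRep I F x₀ x (mvfderiv I (chartChange I x₀ x) x y w)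
      = mvfderiv I (chartChange I x₀ x) x y (F x w)
        + chartChange I x₀ x x (mvfderiv I (endoFieldRep I F x) x y w) := by
  have e : (fun z => endoFieldRep I F x₀ z (chartChange I x₀ x z w)) =ᶠ[nhds x] fun z =>
      chartChange I x₀ x z (endoFieldRep I F x z w) := by
    filter_upwards [(chartAt H x₀).open_source.mem_nhds hx,
      (chartAt H x).open_source.mem_nhds (mem_chart_source H x)] with z hz hz'
    simp only [endoFieldRep, chartChange, ContinuousLinearMap.comp_apply]
    rw [Trivialization.symmL_continuousLinearMapAt _ hz,
      Trivialization.symmL_continuousLinearMapAt _ hz']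
  have hd : MDifferentiableAt I 𝓘(ℝ, E →L[ℝ] E) (endoFieldRep I F x₀) x :=
    ((contMDiffAt_endoFieldRep_iff hx).1 (hF x)).mdifferentiableAt (by simp)
  have hd' := mdifferentiableAt_endoFieldRep hF x
  have hA := mdifferentiableAt_chartChange (I := I) hx
  have hw : MDifferentiableAt I 𝓘(ℝ, E) (fun _ : M => w) x := mdifferentiableAt_const
  have h1 := mvfderiv_clm_apply_eq hd (hA.clm_apply hw) y
  have h2 := mvfderiv_clm_apply_const hA w y
  have h3 := mvfderiv_clm_apply_eq hA (hd'.clm_apply hw) y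
  have h4 := mvfderiv_clm_apply_const hd' w y
  rw [h2] at h1
  rw [h4, endoFieldRep_self, ← mvfderiv_congr_of_eventuallyEq e, h1] at h3
  exact h3

end Rep

section Lifts

variable {v₀ v : TangentBundle I M} (hv : v.proj ∈ (chartAt H v₀.proj).source)
include hv

/-- Lets identities between components in the chart at v₀ be tested on images of pairs (a, b) from
the chart at v, where the lifts have their defining formulas. -/
theorem continuousLinearMapAt_tangent_surjective (u : E × E) : ∃ a b : E,
    (chartChange I v₀.proj v.proj v.proj a,
        mvfderiv I (chartChange I v₀.proj v.proj) v.proj a v.snd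
          + chartChange I v₀.proj v.proj v.proj b) = u := by
  have hv' : v ∈ (trivializationAt (E × E) (TangentSpace I.tangent) v₀).baseSet := by
    simpa using hv
  obtain ⟨w, hw⟩ : ∃ w : TangentSpace I.tangent v,
      (trivializationAt (E × E) (TangentSpace I.tangent) v₀).continuousLinearMapAt ℝ v w = u :=
    ⟨_, Trivialization.continuousLinearMapAt_symmL _ hv' u⟩
  obtain ⟨a, b⟩ := w
  exact ⟨a, b, (continuousLinearMapAt_tangent_trivializationAt hv a b).symm.trans hw⟩

theorem vectorFieldRep_vectorVerticalLift (X : ∀ x : M, TangentSpace I x) :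
    vectorFieldRep I.tangent (vectorVerticalLift I X) v₀ v
      = flatVectorVerticalLift (vectorFieldRep I X v₀.proj ∘ (extChartAt I v₀.proj).symm)
        (extChartAt I.tangent v₀ v) := by
  rw [extChartAt_tangent_eq hv, flatVectorVerticalLift, vectorFieldRep_comp_symm hv]
  refine (continuousLinearMapAt_tangent_trivializationAt hv _ _).trans ?_
  refine Prod.ext (map_zero _) ?_
  refine (congrArg (fun L : E →L[ℝ] E => L v.snd + _)
    (mvfderiv I (chartChange I v₀.proj v.proj) v.proj).map_zero).trans ?_
  exact zero_add _

theorem vectorFieldRep_vectorCompleteLift {X : ∀ x : M, TangentSpace I x}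
    (hX : IsSmoothVectorField I X) :
    vectorFieldRep I.tangent (vectorCompleteLift I X) v₀ v
      = flatVectorCompleteLift (vectorFieldRep I X v₀.proj ∘ (extChartAt I v₀.proj).symm)
        (extChartAt I.tangent v₀ v) := by
  rw [extChartAt_tangent_eq hv, flatVectorCompleteLift, vectorFieldRep_comp_symm hv,
    fderiv_comp_symm_chartChange hv ((contMDiffAt_vectorFieldRep_iff hv).1 (hX _)) v.snd,
    mvfderiv_vectorFieldRep hv hX v.snd, mvfderiv_chartChange_symm (E := E) hv v.snd (X v.proj)]
  exact continuousLinearMapAt_tangent_trivializationAt hv _ _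

theorem oneFormRep_formVerticalLift (α : ∀ x : M, TangentSpace I x →L[ℝ] ℝ) :
    oneFormRep I.tangent (formVerticalLift I α) v₀ v
      = flatFormVerticalLift (oneFormRep I α v₀.proj ∘ (extChartAt I v₀.proj).symm)
        (extChartAt I.tangent v₀ v) := by
  refine ContinuousLinearMap.ext fun u => ?_
  have hv' : v ∈ (trivializationAt (E × E) (TangentSpace I.tangent) v₀).baseSet := by
    simpa using hv
  obtain ⟨a, b, rfl⟩ := continuousLinearMapAt_tangent_surjective hv u
  rw [extChartAt_tangent_eq hv]
  refine Eq.trans ?_ (oneFormRep_comp_symm hv α a).symm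
  rw [← continuousLinearMapAt_tangent_trivializationAt hv]
  exact congrArg (formVerticalLift I α v) (Trivialization.symmL_continuousLinearMapAt (R := ℝ) _
    hv' ((a, b) : E × E))

theorem oneFormRep_formCompleteLift {α : ∀ x : M, TangentSpace I x →L[ℝ] ℝ}
    (hα : IsSmoothOneForm I α) :
    oneFormRep I.tangent (formCompleteLift I α) v₀ v
      = flatFormCompleteLift (oneFormRep I α v₀.proj ∘ (extChartAt I v₀.proj).symm)
        (extChartAt I.tangent v₀ v) := by
  refine ContinuousLinearMap.ext fun u => ?_
  have hv' : v ∈ (trivializationAt (E × E) (TangentSpace I.tangent) v₀).baseSet := by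
    simpa using hv
  obtain ⟨a, b, rfl⟩ := continuousLinearMapAt_tangent_surjective hv u
  have key : oneFormRep I.tangent (formCompleteLift I α) v₀ v
      (chartChange I v₀.proj v.proj v.proj a,
        mvfderiv I (chartChange I v₀.proj v.proj) v.proj a v.snd
          + chartChange I v₀.proj v.proj v.proj b)
      = mvfderiv I (oneFormRep I α v.proj) v.proj v.snd a + α v.proj b := by
    rw [← continuousLinearMapAt_tangent_trivializationAt hv]
    exact congrArg (formCompleteLift I α v) (Trivialization.symmL_continuousLinearMapAt (R := ℝ) _
      hv' ((a, b) : E × E))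
  rw [key, extChartAt_tangent_eq hv]
  simp only [flatFormCompleteLift, add_apply, ContinuousLinearMap.comp_apply,
    ContinuousLinearMap.coe_fst', ContinuousLinearMap.coe_snd', map_add]
  rw [fderiv_comp_symm_chartChange hv (contMDiffAt_oneFormRep hα hv) v.snd,
    oneFormRep_comp_symm hv α b,
    Function.comp_apply, (extChartAt I v₀.proj).left_inv (by rwa [extChartAt_source]),
    mvfderiv_oneFormRep hv hα v.snd a, mvfderiv_chartChange_symm hv a v.snd]
  exact add_assoc _ _ _

theorem endoFieldRep_endoCompleteLift {F : ∀ x : M, TangentSpace I x →L[ℝ] TangentSpace I x}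
    (hF : IsSmoothEndoField I F) :
    endoFieldRep I.tangent (endoCompleteLift I F) v₀ v
      = flatEndoCompleteLift (endoFieldRep I F v₀.proj ∘ (extChartAt I v₀.proj).symm)
        (extChartAt I.tangent v₀ v) := by
  refine ContinuousLinearMap.ext fun u => ?_
  have hv' : v ∈ (trivializationAt (E × E) (TangentSpace I.tangent) v₀).baseSet := by
    simpa using hv
  obtain ⟨a, b, rfl⟩ := continuousLinearMapAt_tangent_surjective hv u
  have key : endoFieldRep I.tangent (endoCompleteLift I F) v₀ v
      (chartChange I v₀.proj v.proj v.proj a,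
        mvfderiv I (chartChange I v₀.proj v.proj) v.proj a v.snd
          + chartChange I v₀.proj v.proj v.proj b)
      = (trivializationAt (E × E) (TangentSpace I.tangent) v₀).continuousLinearMapAt ℝ v
        (endoFieldRep I F v.proj v.proj a, mvfderiv I (endoFieldRep I F v.proj) v.proj v.snd a
          + endoFieldRep I F v.proj v.proj b) := by
    rw [← continuousLinearMapAt_tangent_trivializationAt hv, endoFieldRep_self]
    exact congrArg (fun w : TangentSpace I.tangent v =>
      (trivializationAt (E × E) (TangentSpace I.tangent) v₀).continuousLinearMapAt ℝ v
        (endoCompleteLift I F v w)) (Trivialization.symmL_continuousLinearMapAt (R := ℝ) _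
      hv' ((a, b) : E × E))
  rw [key, extChartAt_tangent_eq hv, continuousLinearMapAt_tangent_trivializationAt hv,
    endoFieldRep_self]
  refine Prod.ext (endoFieldRep_comp_symm hv F a).symm ?_
  simp only [flatEndoCompleteLift, add_apply, ContinuousLinearMap.comp_apply,
    ContinuousLinearMap.coe_fst', ContinuousLinearMap.coe_snd', map_add,
    ContinuousLinearMap.prod_apply]
  rw [fderiv_comp_symm_chartChange hv ((contMDiffAt_endoFieldRep_iff hv).1 (hF _)) v.snd,
    endoFieldRep_comp_symm hv F b, Function.comp_apply,
    (extChartAt I v₀.proj).left_inv (by rwa [extChartAt_source]),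
    mvfderiv_chartChange_symm hv a v.snd]
  have e1 : ∀ P P' Q R U V : E, U + V = P' + Q → P' = P → P + (Q + R) = U + (V + R) := by
    intro P P' Q R U V h h'
    rw [← add_assoc, ← add_assoc, h, h']
  -- What remains is the derivative of F' A = A F along the fibre vector, with one D²τ term
  -- transposed by symmetry.
  exact e1 _ _ _ _ _ _ (mvfderiv_endoFieldRep hv hF v.snd a)
    (mvfderiv_chartChange_symm (E := E) hv v.snd (F v.proj a))

end Lifts

end Boundaryless

end TangentCoordinates

/-! ### The Nijenhuis tensor in a chart -/

section NijenhuisCoordinates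

variable {E : Type*} [NormedAddCommGroup E] [NormedSpace ℝ E]
  {H : Type*} [TopologicalSpace H] {I : ModelWithCorners ℝ E H}
  {M : Type*} [TopologicalSpace M] [ChartedSpace H M] [IsManifold I ∞ M]
  {x₀ x : M}

theorem continuousLinearMapAt_endo (F : ∀ x : M, TangentSpace I x →L[ℝ] TangentSpace I x)
    (hx : x ∈ (chartAt H x₀).source) (w : TangentSpace I x) :
    (trivializationAt E (TangentSpace I) x₀).continuousLinearMapAt ℝ x (F x w)
      = endoFieldRep I F x₀ x
        ((trivializationAt E (TangentSpace I) x₀).continuousLinearMapAt ℝ x w) := by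
  simp only [endoFieldRep, ContinuousLinearMap.comp_apply]
  rw [Trivialization.symmL_continuousLinearMapAt _ hx]

theorem oneForm_eq_oneFormRep (α : ∀ x : M, TangentSpace I x →L[ℝ] ℝ)
    (hx : x ∈ (chartAt H x₀).source) (w : TangentSpace I x) :
    α x w = oneFormRep I α x₀ x
        ((trivializationAt E (TangentSpace I) x₀).continuousLinearMapAt ℝ x w) := by
  simp only [oneFormRep, ContinuousLinearMap.comp_apply]
  rw [Trivialization.symmL_continuousLinearMapAt _ hx]

theorem vectorFieldRep_endo (F : ∀ x : M, TangentSpace I x →L[ℝ] TangentSpace I x)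
    (X : ∀ x : M, TangentSpace I x) (hx : x ∈ (chartAt H x₀).source) :
    vectorFieldRep I (fun z => F z (X z)) x₀ x
      = endoFieldRep I F x₀ x (vectorFieldRep I X x₀ x) :=
  continuousLinearMapAt_endo F hx _

theorem vectorFieldRep_endo_comp_symm (F : ∀ x : M, TangentSpace I x →L[ℝ] TangentSpace I x)
    (X : ∀ x : M, TangentSpace I x) {u : E} (hu : u ∈ (extChartAt I x₀).target) :
    (vectorFieldRep I (fun z => F z (X z)) x₀ ∘ (extChartAt I x₀).symm) u
      = (endoFieldRep I F x₀ ∘ (extChartAt I x₀).symm) u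
        ((vectorFieldRep I X x₀ ∘ (extChartAt I x₀).symm) u) := by
  have := (extChartAt I x₀).map_target hu
  rw [extChartAt_source] at this
  exact vectorFieldRep_endo F X this

theorem IsSmoothVectorField.endo {F : ∀ x : M, TangentSpace I x →L[ℝ] TangentSpace I x}
    {X : ∀ x : M, TangentSpace I x}
    (hF : IsSmoothEndoField I F) (hX : IsSmoothVectorField I X) :
    IsSmoothVectorField I (fun z => F z (X z)) :=
  ContMDiff.clm_bundle_apply (F₁ := E) (F₂ := E) (E₁ := fun x : M => TangentSpace I x)
    (E₂ := fun x : M => TangentSpace I x) (b := fun x => x) hF hX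

theorem IsSmoothVectorField.mdifferentiableAt {X : ∀ x : M, TangentSpace I x}
    (hX : IsSmoothVectorField I X) (x : M) :
    MDifferentiableAt I I.tangent (fun x => (⟨x, X x⟩ : TangentBundle I M)) x :=
  hX.mdifferentiable (by simp) x

variable [I.Boundaryless]

omit [I.Boundaryless] in
theorem contMDiffAt_vectorFieldRep_endo {F : ∀ x : M, TangentSpace I x →L[ℝ] TangentSpace I x}
    {X : ∀ x : M, TangentSpace I x} (hx : x ∈ (chartAt H x₀).source)
    (hF : ContMDiffAt I 𝓘(ℝ, E →L[ℝ] E) ∞ (endoFieldRep I F x₀) x)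
    (hX : ContMDiffAt I 𝓘(ℝ, E) ∞ (vectorFieldRep I X x₀) x) :
    ContMDiffAt I 𝓘(ℝ, E) ∞ (vectorFieldRep I (fun z => F z (X z)) x₀) x := by
  refine (hF.clm_apply hX).congr_of_eventuallyEq ?_
  filter_upwards [(chartAt H x₀).open_source.mem_nhds hx] with z hz
  exact vectorFieldRep_endo F X hz

theorem continuousLinearMapAt_nijenhuis [CompleteSpace E]
    {F : ∀ x : M, TangentSpace I x →L[ℝ] TangentSpace I x}
    {X Y : ∀ x : M, TangentSpace I x} (hx : x ∈ (chartAt H x₀).source)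
    (hF : ContMDiffAt I 𝓘(ℝ, E →L[ℝ] E) ∞ (endoFieldRep I F x₀) x)
    (hX : ContMDiffAt I 𝓘(ℝ, E) ∞ (vectorFieldRep I X x₀) x)
    (hY : ContMDiffAt I 𝓘(ℝ, E) ∞ (vectorFieldRep I Y x₀) x) :
    (trivializationAt E (TangentSpace I) x₀).continuousLinearMapAt ℝ x (nijenhuis I F X Y x)
      = flatNijenhuis (endoFieldRep I F x₀ ∘ (extChartAt I x₀).symm) (extChartAt I x₀ x)
        (vectorFieldRep I X x₀ x) (vectorFieldRep I Y x₀ x) := by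
  have hx' : x ∈ (extChartAt I x₀).source := by rwa [extChartAt_source]
  have hFX := contMDiffAt_vectorFieldRep_endo hx hF hX
  have hFY := contMDiffAt_vectorFieldRep_endo hx hF hY
  have ev : ∀ Z : ∀ x : M, TangentSpace I x,
      vectorFieldRep I (fun z => F z (Z z)) x₀ ∘ (extChartAt I x₀).symm
        =ᶠ[nhds (extChartAt I x₀ x)] fun u => (endoFieldRep I F x₀ ∘ (extChartAt I x₀).symm) u
        ((vectorFieldRep I Z x₀ ∘ (extChartAt I x₀).symm) u) := by
    intro Z
    filter_upwards [extChartAt_target_mem_nhds' ((extChartAt I x₀).map_source hx')] with u hu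
    exact vectorFieldRep_endo_comp_symm F Z hu
  have e : ∀ {G : Type _} (f : M → G),
      f x = (f ∘ (extChartAt I x₀).symm) (extChartAt I x₀ x) := by
    intro G f
    rw [Function.comp_apply, (extChartAt I x₀).left_inv hx']
  have s : ∀ {G : Type _} [NormedAddCommGroup G] [NormedSpace ℝ G] {f : M → G},
      ContMDiffAt I 𝓘(ℝ, G) ∞ f x →
      DifferentiableAt ℝ (f ∘ (extChartAt I x₀).symm) (extChartAt I x₀ x) := fun hf =>
    (contDiffAt_comp_extChartAt_symm hx hf).differentiableAt (by simp)
  rw [nijenhuis, map_add, map_sub, map_sub]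
  rw [continuousLinearMapAt_endo F hx, continuousLinearMapAt_endo F hx,
    continuousLinearMapAt_endo F hx, continuousLinearMapAt_endo F hx,
    continuousLinearMapAt_mlieBracket hx hFX hFY, continuousLinearMapAt_mlieBracket hx hFX hY,
    continuousLinearMapAt_mlieBracket hx hX hFY, continuousLinearMapAt_mlieBracket hx hX hY,
    (ev X).lieBracket_vectorField_eq (ev Y),
    (ev X).lieBracket_vectorField_eq (Filter.EventuallyEq.refl _ _),
    (Filter.EventuallyEq.refl _ _).lieBracket_vectorField_eq (ev Y),
    e (endoFieldRep I F x₀), e (vectorFieldRep I X x₀), e (vectorFieldRep I Y x₀)]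
  exact lieBracket_endo_eq_flatNijenhuis (s hF) (s hX) (s hY)

end NijenhuisCoordinates

/-! ### Consequences of the P-Sasakian equation -/

section PSasakianIdentities

variable {E : Type*} [NormedAddCommGroup E] [NormedSpace ℝ E] [FiniteDimensional ℝ E]
  {H : Type*} [TopologicalSpace H] {I : ModelWithCorners ℝ E H}
  {M : Type*} [TopologicalSpace M] [ChartedSpace H M] [IsManifold I ∞ M]
  [RiemannianBundle (fun x : M => TangentSpace I x)]
  [IsContMDiffRiemannianBundle I ∞ E (fun x : M => TangentSpace I x)]
  {nabla : CovariantDerivative I E (fun x : M => TangentSpace I x)}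
  {φ : ∀ x : M, TangentSpace I x →L[ℝ] TangentSpace I x}
  {η : ∀ x : M, TangentSpace I x →L[ℝ] ℝ} {ξ : ∀ x : M, TangentSpace I x}

namespace IsPSasakian

variable (h : IsPSasakian I nabla φ η ξ)
include h

theorem inner_xi (x : M) (v : TangentSpace I x) : inner ℝ v (ξ x) = η x v := by
  rw [h.metric_compatible, h.paracontact.phi_xi, h.paracontact.eta_xi, inner_zero_right]
  ring

/-- Metric compatibility gives g(φv, w) = g(φ²v, φw) = g(v, φw) - η(v) g(ξ, φw), and the last term
is zero because η ∘ φ = 0. -/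
theorem inner_phi (x : M) (v w : TangentSpace I x) :
    inner ℝ (φ x v) w = inner ℝ v (φ x w) := by
  have h0 : inner ℝ (ξ x) (φ x w) = 0 := by
    rw [real_inner_comm, h.inner_xi, h.paracontact.eta_phi]
  rw [h.metric_compatible x (φ x v) w, h.paracontact.phi_phi, h.paracontact.eta_phi,
    inner_sub_left, inner_smul_left, h0]
  simp

theorem nabla_sub_nabla {X Y : ∀ x : M, TangentSpace I x} (hX : IsSmoothVectorField I X)
    (hY : IsSmoothVectorField I Y) (x : M) :
    nabla Y x (X x) - nabla X x (Y x) = mlieBracket I X Y x := by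
  have : CompleteSpace E := FiniteDimensional.complete ℝ E
  exact (CovariantDerivative.torsion_eq_zero_iff nabla).1 h.leviCivita.2
    (hX.mdifferentiableAt x) (hY.mdifferentiableAt x)

theorem mvfderiv_inner {X Y Z : ∀ x : M, TangentSpace I x} (hX : IsSmoothVectorField I X)
    (hY : IsSmoothVectorField I Y) (x : M) :
    mvfderiv I (fun z => (inner ℝ (X z) (Y z) : ℝ)) x (Z x)
      = inner ℝ (nabla X x (Z x)) (Y x) + inner ℝ (X x) (nabla Y x (Z x)) :=
  h.leviCivita.1.mvfderiv_inner_eq Z (hX.mdifferentiableAt x) (hY.mdifferentiableAt x)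

/-- Differentiate g(ξ, ξ) = 1. -/
theorem eta_nabla_xi {X : ∀ x : M, TangentSpace I x} (x : M) :
    η x (nabla ξ x (X x)) = 0 := by
  have hξ := h.paracontact.smooth_xi
  have h1 := h.mvfderiv_inner (Z := X) hξ hξ x
  have h2 : (fun z => (inner ℝ (ξ z) (ξ z) : ℝ)) = fun _ => 1 := by
    funext z
    rw [h.inner_xi, h.paracontact.eta_xi]
  rw [h2, mvfderiv_const, h.inner_xi, real_inner_comm, h.inner_xi] at h1
  have h3 : (0 : ℝ) = η x (nabla ξ x (X x)) + η x (nabla ξ x (X x)) := h1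
  linarith

/-- The P-Sasakian equation at Y = ξ, where φξ = 0 leaves only -φ(∇_X ξ) on the left. -/
theorem phi_nabla_xi {X : ∀ x : M, TangentSpace I x} (hX : IsSmoothVectorField I X) (x : M) :
    φ x (nabla ξ x (X x)) = X x - η x (X x) • ξ x := by
  have h1 := h.nabla_phi X ξ hX h.paracontact.smooth_xi x
  have h2 : (fun z => φ z (ξ z)) = 0 := funext h.paracontact.phi_xi
  rw [h2, nabla.isCovariantDerivativeOn.zero, h.inner_xi, h.paracontact.eta_xi, zero_apply] at h1
  linear_combination (norm := module) (-1 : ℝ) • h1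

theorem nabla_xi {X : ∀ x : M, TangentSpace I x} (hX : IsSmoothVectorField I X) (x : M) :
    nabla ξ x (X x) = φ x (X x) := by
  have h1 := congrArg (φ x) (h.phi_nabla_xi hX x)
  rwa [h.paracontact.phi_phi, h.eta_nabla_xi, map_sub, map_smul, h.paracontact.phi_xi, zero_smul,
    smul_zero, sub_zero, sub_zero] at h1

/-- Without torsion, N_φ(X, Y) = (∇_{φX} φ)Y - (∇_{φY} φ)X - φ(∇_X φ)Y + φ(∇_Y φ)X. The ξ-terms
cancel by self-adjointness of φ, and the remaining ones, η(Y) φX and η(X) φY, cancel in pairs. -/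
theorem nijenhuis_phi {X Y : ∀ x : M, TangentSpace I x} (hX : IsSmoothVectorField I X)
    (hY : IsSmoothVectorField I Y) (x : M) : nijenhuis I φ X Y x = 0 := by
  have hφ := h.paracontact.smooth_phi
  have hφX := hX.endo hφ
  have hφY := hY.endo hφ
  have p1 := h.nabla_phi _ Y hφX hY x
  have p2 := h.nabla_phi _ X hφY hX x
  have p3 := congrArg (φ x) (h.nabla_phi X Y hX hY x)
  have p4 := congrArg (φ x) (h.nabla_phi Y X hY hX x)
  rw [h.inner_phi] at p1
  rw [real_inner_comm] at p2
  simp only [h.paracontact.eta_phi, map_add, map_sub, map_neg, map_smul, neg_smul,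
    h.paracontact.phi_xi, smul_zero, neg_zero, zero_sub, add_zero, mul_zero, zero_mul,
    zero_smul] at p1 p2 p3 p4
  rw [nijenhuis, ← h.nabla_sub_nabla hφX hφY, ← h.nabla_sub_nabla hφX hY,
    ← h.nabla_sub_nabla hX hφY, ← h.nabla_sub_nabla hX hY]
  simp only [map_sub]
  linear_combination (norm := module) p1 - p2 - p3 + p4

/-- As ∇ξ = φ, the difference of the two sides is (∇_ξ φ)Y, and the P-Sasakian equation gives -η(Y)ξ
- η(Y)ξ + 2η(Y)ξ = 0. -/
theorem mlieBracket_xi_phi {Y : ∀ x : M, TangentSpace I x} (hY : IsSmoothVectorField I Y)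
    (x : M) : mlieBracket I ξ (fun z => φ z (Y z)) x = φ x (mlieBracket I ξ Y x) := by
  have hξ := h.paracontact.smooth_xi
  have hφY := hY.endo h.paracontact.smooth_phi
  have p := h.nabla_phi ξ Y hξ hY x
  rw [real_inner_comm, h.inner_xi, h.paracontact.eta_xi] at p
  rw [← h.nabla_sub_nabla hξ hφY, ← h.nabla_sub_nabla hξ hY, h.nabla_xi hφY, h.nabla_xi hY,
    map_sub]
  linear_combination (norm := module) p

theorem mvfderiv_eta {X Y : ∀ x : M, TangentSpace I x} (hX : IsSmoothVectorField I X)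
    (hY : IsSmoothVectorField I Y) (x : M) :
    mvfderiv I (fun z => η z (Y z)) x (X x)
      = η x (nabla Y x (X x)) + inner ℝ (Y x) (φ x (X x)) := by
  have h1 : (fun z => η z (Y z)) = fun z => (inner ℝ (Y z) (ξ z) : ℝ) :=
    funext fun z => (h.inner_xi z (Y z)).symm
  rw [h1, h.mvfderiv_inner hY h.paracontact.smooth_xi, h.inner_xi, h.nabla_xi hX]

/-- This says dη = 0: the covariant derivative of η is (X, Y) ↦ g(Y, φX), symmetric since φ is
self-adjoint. -/
theorem mvfderiv_eta_sub {X Y : ∀ x : M, TangentSpace I x} (hX : IsSmoothVectorField I X)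
    (hY : IsSmoothVectorField I Y) (x : M) :
    mvfderiv I (fun z => η z (Y z)) x (X x) - mvfderiv I (fun z => η z (X z)) x (Y x)
      = η x (mlieBracket I X Y x) := by
  rw [h.mvfderiv_eta hX hY, h.mvfderiv_eta hY hX, ← h.nabla_sub_nabla hX hY, map_sub,
    ← h.inner_phi x (X x), real_inner_comm (Y x) (φ x (X x))]
  ring

end IsPSasakian

end PSasakianIdentities

/-! ### Global extensions of coordinate-constant fields -/

section ConstantFields

variable {E : Type*} [NormedAddCommGroup E] [NormedSpace ℝ E] [FiniteDimensional ℝ E]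
  {H : Type*} [TopologicalSpace H] {I : ModelWithCorners ℝ E H}
  {M : Type*} [TopologicalSpace M] [T2Space M] [ChartedSpace H M] [IsManifold I ∞ M]

/-- Near any point, coordinate-constant vector fields extend to smooth global vector fields. -/
theorem exists_isSmoothVectorField_rep_const (x₀ : M) : ∃ U : Set M, IsOpen U ∧ x₀ ∈ U ∧
    U ⊆ (chartAt H x₀).source ∧ ∀ a : E, ∃ X : ∀ x : M, TangentSpace I x,
      IsSmoothVectorField I X ∧ ∀ z ∈ U, vectorFieldRep I X x₀ z = a := by
  obtain ⟨f⟩ : Nonempty (SmoothBumpFunction I x₀) := inferInstance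
  obtain ⟨U, hU, hUo, hxU⟩ := eventually_nhds_iff.1
    (f.eventuallyEq_one.and ((chartAt H x₀).open_source.mem_nhds (mem_chart_source H x₀)))
  refine ⟨U, hUo, hxU, fun z hz => (hU z hz).2, fun a => ?_⟩
  -- A bump function times the coordinate-constant field. U is a neighbourhood where the bump equals
  -- one, so it serves every a.
  refine ⟨(f : M → ℝ) • fun z => (trivializationAt E (TangentSpace I) x₀).symmL ℝ z a, ?_, ?_⟩
  · refine ContMDiffOn.smul_section_of_tsupport (u := (chartAt H x₀).source)
      f.contMDiff.contMDiffOn (chartAt H x₀).open_source f.tsupport_subset_chartAt_source ?_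
    intro z hz
    refine ContMDiffAt.contMDiffWithinAt ((contMDiffAt_vectorFieldRep_iff hz).2 ?_)
    refine (contMDiffAt_const (c := a)).congr_of_eventuallyEq ?_
    filter_upwards [(chartAt H x₀).open_source.mem_nhds hz] with w hw
    exact Trivialization.continuousLinearMapAt_symmL _
      (show w ∈ (trivializationAt E (TangentSpace I) x₀).baseSet from hw) a
  · intro z hz
    have h1 := (hU z hz).1
    have hz' : z ∈ (trivializationAt E (TangentSpace I) x₀).baseSet := (hU z hz).2
    rw [vectorFieldRep]
    simp only [Pi.smul_apply', h1, Pi.one_apply, one_smul]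
    exact Trivialization.continuousLinearMapAt_symmL _ hz' a

end ConstantFields

/-! ### From the P-Sasakian manifold to a chart -/

section LocalStructure

variable {E : Type*} [NormedAddCommGroup E] [NormedSpace ℝ E] [FiniteDimensional ℝ E]
  {H : Type*} [TopologicalSpace H] {I : ModelWithCorners ℝ E H} [I.Boundaryless]
  {M : Type*} [TopologicalSpace M] [T2Space M] [ChartedSpace H M] [IsManifold I ∞ M]
  [RiemannianBundle (fun x : M => TangentSpace I x)]
  [IsContMDiffRiemannianBundle I ∞ E (fun x : M => TangentSpace I x)]
  {nabla : CovariantDerivative I E (fun x : M => TangentSpace I x)}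
  {φ : ∀ x : M, TangentSpace I x →L[ℝ] TangentSpace I x}
  {η : ∀ x : M, TangentSpace I x →L[ℝ] ℝ} {ξ : ∀ x : M, TangentSpace I x}

omit [FiniteDimensional ℝ E] [I.Boundaryless] [T2Space M] [IsManifold I ∞ M]
  [RiemannianBundle (fun x : M => TangentSpace I x)]
  [IsContMDiffRiemannianBundle I ∞ E (fun x : M => TangentSpace I x)] in
theorem comp_extChartAt_symm_eventuallyEq_const {G : Type*} {f : M → G} {c : G} {U : Set M}
    (hU : IsOpen U) {x₀ z : M} (hz : z ∈ U) (hz' : z ∈ (chartAt H x₀).source)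
    (hf : ∀ w ∈ U, f w = c) :
    f ∘ (extChartAt I x₀).symm =ᶠ[nhds (extChartAt I x₀ z)] fun _ => c := by
  have hs : z ∈ (extChartAt I x₀).source := by rwa [extChartAt_source]
  have hc := continuousAt_extChartAt_symm' hs
  have hn : U ∈ nhds ((extChartAt I x₀).symm (extChartAt I x₀ z)) := by
    rw [(extChartAt I x₀).left_inv hs]
    exact hU.mem_nhds hz
  filter_upwards [hc hn] with u hu
  exact hf _ hu

/-- The global identities involve smooth fields on all of M. Testing them on extensions of
coordinate-constant fields turns dη = 0, L_ξ φ = 0 and N_φ = 0 into pointwise identities for the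
components. -/
theorem IsPSasakian.exists_isFlatNormalParacontact (h : IsPSasakian I nabla φ η ξ) (x₀ : M) :
    ∃ U : Set E, extChartAt I x₀ x₀ ∈ U ∧ IsFlatNormalParacontact U
      (endoFieldRep I φ x₀ ∘ (extChartAt I x₀).symm)
      (oneFormRep I η x₀ ∘ (extChartAt I x₀).symm)
      (vectorFieldRep I ξ x₀ ∘ (extChartAt I x₀).symm) := by
  have : CompleteSpace E := FiniteDimensional.complete ℝ E
  obtain ⟨U, hUo, hxU, hU, hconst⟩ := exists_isSmoothVectorField_rep_const (I := I) x₀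
  have hφ := h.paracontact.smooth_phi
  have hη := h.paracontact.smooth_eta
  have hξ := h.paracontact.smooth_xi
  refine ⟨(extChartAt I x₀).target ∩ (extChartAt I x₀).symm ⁻¹' U,
    ⟨mem_extChartAt_target x₀, by simpa using hxU⟩, ?_⟩
  have red : ∀ {P : E → Prop}, (∀ z ∈ U, P (extChartAt I x₀ z)) →
      ∀ u ∈ (extChartAt I x₀).target ∩ (extChartAt I x₀).symm ⁻¹' U, P u := by
    intro P hP u hu
    have := hP _ hu.2
    rwa [(extChartAt I x₀).right_inv hu.1] at this
  have e : ∀ {z : M} (_ : z ∈ U) {G : Type _} (f : M → G),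
      (f ∘ (extChartAt I x₀).symm) (extChartAt I x₀ z) = f z := by
    intro z hz G f
    rw [Function.comp_apply, (extChartAt I x₀).left_inv (by rw [extChartAt_source]; exact hU hz)]
  have ex : ∀ {z : M} (_ : z ∈ U) (a : E), ∃ w : TangentSpace I z,
      (trivializationAt E (TangentSpace I) x₀).continuousLinearMapAt ℝ z w = a := fun hz a =>
    ⟨_, Trivialization.continuousLinearMapAt_symmL _ (hU hz) a⟩
  have sφ : ∀ z ∈ U, ContMDiffAt I 𝓘(ℝ, E →L[ℝ] E) ∞ (endoFieldRep I φ x₀) z := fun z hz =>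
    (contMDiffAt_endoFieldRep_iff (hU hz)).1 (hφ z)
  have sη : ∀ z ∈ U, ContMDiffAt I 𝓘(ℝ, E →L[ℝ] ℝ) ∞ (oneFormRep I η x₀) z := fun z hz =>
    contMDiffAt_oneFormRep hη (hU hz)
  have sv : ∀ {X : ∀ x : M, TangentSpace I x} (_ : IsSmoothVectorField I X), ∀ z ∈ U,
      ContMDiffAt I 𝓘(ℝ, E) ∞ (vectorFieldRep I X x₀) z := fun hX z hz =>
    (contMDiffAt_vectorFieldRep_iff (hU hz)).1 (hX z)
  refine ⟨(continuousOn_extChartAt_symm x₀).isOpen_inter_preimage (isOpen_extChartAt_target x₀) hUo,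
    red fun z hz => contDiffAt_comp_extChartAt_symm (hU hz) (sφ z hz),
    red fun z hz => contDiffAt_comp_extChartAt_symm (hU hz) (sη z hz),
    red fun z hz => contDiffAt_comp_extChartAt_symm (hU hz) (sv hξ z hz),
    red fun z hz a => ?_, red fun z hz => ?_, red fun z hz => ?_, red fun z hz a => ?_,
    red fun z hz a b => ?_, red fun z hz a => ?_, red fun z hz a b => ?_⟩
  · rw [e hz, e hz, e hz]
    obtain ⟨w, rfl⟩ := ex hz a
    rw [← continuousLinearMapAt_endo φ (hU hz), ← continuousLinearMapAt_endo φ (hU hz),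
      ← oneForm_eq_oneFormRep η (hU hz), h.paracontact.phi_phi, map_sub, map_smul]
    rfl
  · rw [e hz, e hz, ← h.paracontact.eta_xi z, oneForm_eq_oneFormRep η (hU hz)]
    rfl
  · rw [e hz, e hz, ← vectorFieldRep_endo φ ξ (hU hz), vectorFieldRep, h.paracontact.phi_xi,
      map_zero]
  · rw [e hz, e hz]
    obtain ⟨w, rfl⟩ := ex hz a
    rw [← continuousLinearMapAt_endo φ (hU hz), ← oneForm_eq_oneFormRep η (hU hz),
      h.paracontact.eta_phi]
  · obtain ⟨X, hX, hXa⟩ := hconst a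
    obtain ⟨Y, hY, hYb⟩ := hconst b
    -- Coordinate-constant fields commute, so the bracket term in dη drops out.
    have hbr : mlieBracket I X Y z = 0 := by
      have hc := continuousLinearMapAt_mlieBracket (hU hz) (sv hX z hz) (sv hY z hz)
      have cX := comp_extChartAt_symm_eventuallyEq_const (I := I) hUo hz (hU hz) hXa
      have cY := comp_extChartAt_symm_eventuallyEq_const (I := I) hUo hz (hU hz) hYb
      rw [cX.lieBracket_vectorField_eq cY] at hc
      have h0 : lieBracket ℝ (fun _ : E => a) (fun _ => b) (extChartAt I x₀ z) = 0 := by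
        simp [lieBracket]
      rw [h0] at hc
      rw [← Trivialization.symmL_continuousLinearMapAt (R := ℝ)
        (trivializationAt E (TangentSpace I) x₀) (hU hz) (mlieBracket I X Y z), hc, map_zero]
    have key : ∀ {X Y : ∀ x : M, TangentSpace I x} {a b : E},
        (∀ z ∈ U, vectorFieldRep I X x₀ z = a) → (∀ z ∈ U, vectorFieldRep I Y x₀ z = b) →
        mvfderiv I (fun z => η z (Y z)) z (X z) = fderiv ℝ (oneFormRep I η x₀ ∘
          (extChartAt I x₀).symm) (extChartAt I x₀ z) a b := by
      intro X Y a b hXa hYb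
      have h1 : (fun z => η z (Y z)) =ᶠ[nhds z] fun z => oneFormRep I η x₀ z b := by
        filter_upwards [hUo.mem_nhds hz] with w hw
        rw [oneForm_eq_oneFormRep η (hU hw), ← hYb w hw]
        rfl
      have hd := (sη z hz).mdifferentiableAt (by simp)
      rw [mvfderiv_congr_of_eventuallyEq h1, mvfderiv_clm_apply_const hd b (X z),
        mvfderiv_eq_fderiv_comp_extChartAt_symm (hU hz) hd, ← hXa z hz]
      rfl
    have := h.mvfderiv_eta_sub hX hY z
    rw [hbr, map_zero, key hXa hYb, key hYb hXa] at this
    exact sub_eq_zero.1 this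
  · obtain ⟨X, hX, hXa⟩ := hconst a
    have hp := congrArg ((trivializationAt E (TangentSpace I) x₀).continuousLinearMapAt ℝ z)
      (h.mlieBracket_xi_phi hX z)
    rw [continuousLinearMapAt_endo φ (hU hz),
      continuousLinearMapAt_mlieBracket (hU hz) (sv hξ z hz) (sv (hX.endo hφ) z hz),
      continuousLinearMapAt_mlieBracket (hU hz) (sv hξ z hz) (sv hX z hz)] at hp
    have cX := comp_extChartAt_symm_eventuallyEq_const (I := I) hUo hz (hU hz) hXa
    have cφ : vectorFieldRep I (fun z => φ z (X z)) x₀ ∘ (extChartAt I x₀).symm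
        =ᶠ[nhds (extChartAt I x₀ z)] fun u =>
          (endoFieldRep I φ x₀ ∘ (extChartAt I x₀).symm) u a := by
      filter_upwards [cX, extChartAt_target_mem_nhds' ((extChartAt I x₀).map_source
        (by rw [extChartAt_source]; exact hU hz))] with u hu hu'
      rw [vectorFieldRep_endo_comp_symm φ X hu', hu]
    rw [(Filter.EventuallyEq.refl _ _).lieBracket_vectorField_eq cφ,
      (Filter.EventuallyEq.refl _ _).lieBracket_vectorField_eq cX] at hp
    have dφ := (contDiffAt_comp_extChartAt_symm (hU hz) (sφ z hz)).differentiableAt (by simp)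
    have hd : fderiv ℝ (fun u => (endoFieldRep I φ x₀ ∘ (extChartAt I x₀).symm) u a)
        (extChartAt I x₀ z) = (fderiv ℝ (endoFieldRep I φ x₀ ∘ (extChartAt I x₀).symm)
        (extChartAt I x₀ z)).flip a := by
      rw [fderiv_clm_apply dφ (differentiableAt_const a)]
      simp
    rw [lieBracket, lieBracket, hd, fderiv_const_apply, zero_apply, zero_sub, map_neg,
      ContinuousLinearMap.flip_apply, ← e hz (endoFieldRep I φ x₀)] at hp
    rw [hp, neg_add_cancel]
  · obtain ⟨X, hX, hXa⟩ := hconst a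
    obtain ⟨Y, hY, hYb⟩ := hconst b
    have := continuousLinearMapAt_nijenhuis (hU hz) (sφ z hz) (sv hX z hz) (sv hY z hz)
    rw [h.nijenhuis_phi hX hY, hXa z hz, hYb z hz, map_zero] at this
    exact this.symm

end LocalStructure

/-! ### Components of J in an induced chart -/

section Metallic

variable {E : Type*} [NormedAddCommGroup E] [NormedSpace ℝ E]
  {H : Type*} [TopologicalSpace H] {I : ModelWithCorners ℝ E H}
  {M : Type*} [TopologicalSpace M] [ChartedSpace H M] [IsManifold I ∞ M]

theorem endoFieldRep_add (F G : ∀ x : M, TangentSpace I x →L[ℝ] TangentSpace I x) (x₀ x : M) :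
    endoFieldRep I (fun z => F z + G z) x₀ x = endoFieldRep I F x₀ x + endoFieldRep I G x₀ x := by
  simp only [endoFieldRep, ContinuousLinearMap.add_comp, ContinuousLinearMap.comp_add]

theorem endoFieldRep_smul_id_sub_smul (F : ∀ x : M, TangentSpace I x →L[ℝ] TangentSpace I x)
    {x₀ x : M} (hx : x ∈ (chartAt H x₀).source) (c s : ℝ) :
    endoFieldRep I (fun z => c • ContinuousLinearMap.id ℝ (TangentSpace I z) - s • F z) x₀ x
      = c • ContinuousLinearMap.id ℝ E - s • endoFieldRep I F x₀ x := by
  ext v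
  have := Trivialization.continuousLinearMapAt_symmL (R := ℝ)
    (trivializationAt E (TangentSpace I) x₀) hx v
  simp [endoFieldRep, this]

theorem endoFieldRep_smulRight (α : ∀ x : M, TangentSpace I x →L[ℝ] ℝ)
    (X : ∀ x : M, TangentSpace I x) (x₀ x : M) :
    endoFieldRep I (fun z => (α z).smulRight (X z)) x₀ x
      = (oneFormRep I α x₀ x).smulRight (vectorFieldRep I X x₀ x) := by
  ext v
  simp [endoFieldRep, oneFormRep, vectorFieldRep]

variable [I.Boundaryless]
  {φ : ∀ x : M, TangentSpace I x →L[ℝ] TangentSpace I x}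
  {η : ∀ x : M, TangentSpace I x →L[ℝ] ℝ} {ξ : ∀ x : M, TangentSpace I x}

theorem endoFieldRep_completeLiftMetallic (hφ : IsSmoothEndoField I φ) (hη : IsSmoothOneForm I η)
    (hξ : IsSmoothVectorField I ξ) (p q : ℕ) {v₀ v : TangentBundle I M}
    (hv : v.proj ∈ (chartAt H v₀.proj).source) :
    endoFieldRep I.tangent (completeLiftMetallic I p q φ η ξ) v₀ v
      = ((p : ℝ) / 2) • ContinuousLinearMap.id ℝ (E × E)
        - ((2 * metallicMean p q - p) / 2) • flatProductLift
          (endoFieldRep I φ v₀.proj ∘ (extChartAt I v₀.proj).symm)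
          (oneFormRep I η v₀.proj ∘ (extChartAt I v₀.proj).symm)
          (vectorFieldRep I ξ v₀.proj ∘ (extChartAt I v₀.proj).symm)
          (extChartAt I.tangent v₀ v) := by
  have hv' : v ∈ (chartAt (ModelProd H E) v₀).source := by simpa using hv
  unfold completeLiftMetallic
  rw [endoFieldRep_smul_id_sub_smul _ hv', endoFieldRep_add, endoFieldRep_add,
    endoFieldRep_smulRight, endoFieldRep_smulRight, endoFieldRep_endoCompleteLift hv hφ,
    oneFormRep_formVerticalLift hv, oneFormRep_formCompleteLift hv hη,
    vectorFieldRep_vectorVerticalLift hv, vectorFieldRep_vectorCompleteLift hv hξ]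
  rfl

end Metallic

/-- 2σ_{p,q} - p is the square root of p² + 4q. -/
theorem sq_metallicMean_sub (p q : ℕ) :
    ((2 * metallicMean p q - p) / 2) ^ 2 = (p : ℝ) ^ 2 / 4 + q := by
  have h : Real.sqrt ((p : ℝ) ^ 2 + 4 * q) ^ 2 = (p : ℝ) ^ 2 + 4 * q :=
    Real.sq_sqrt (by positivity)
  rw [metallicMean]
  linear_combination h / 4

theorem Filter.EventuallyEq.flatNijenhuis_eq {W : Type*} [NormedAddCommGroup W] [NormedSpace ℝ W]
    {F G : W → W →L[ℝ] W} {w : W} (h : F =ᶠ[nhds w] G) (u v : W) :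
    flatNijenhuis F w u v = flatNijenhuis G w u v := by
  simp only [flatNijenhuis, h.fderiv_eq, h.eq_of_nhds]

/-! ### The metallic identity and integrability of J -/

section ProductLift

variable {E : Type*} [NormedAddCommGroup E] [NormedSpace ℝ E] [FiniteDimensional ℝ E]
  {H : Type*} [TopologicalSpace H] {I : ModelWithCorners ℝ E H} [I.Boundaryless]
  {M : Type*} [TopologicalSpace M] [T2Space M] [ChartedSpace H M] [IsManifold I ∞ M]
  [RiemannianBundle (fun x : M => TangentSpace I x)]
  [IsContMDiffRiemannianBundle I ∞ E (fun x : M => TangentSpace I x)]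
  {nabla : CovariantDerivative I E (fun x : M => TangentSpace I x)}
  {φ : ∀ x : M, TangentSpace I x →L[ℝ] TangentSpace I x}
  {η : ∀ x : M, TangentSpace I x →L[ℝ] ℝ} {ξ : ∀ x : M, TangentSpace I x}

namespace IsPSasakian

/-- In the induced chart, `completeLiftMetallic` is an affine function of a smooth flat product
structure which is integrable. -/
theorem exists_flatProductStructure (h : IsPSasakian I nabla φ η ξ) (p q : ℕ)
    (v : TangentBundle I M) : ∃ F : E × E → (E × E) →L[ℝ] E × E,
      (∀ᶠ w in nhds v, endoFieldRep I.tangent (completeLiftMetallic I p q φ η ξ) v w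
        = ((p : ℝ) / 2) • ContinuousLinearMap.id ℝ (E × E)
          - ((2 * metallicMean p q - p) / 2) • F (extChartAt I.tangent v w)) ∧
      ContDiffAt ℝ ∞ F (extChartAt I.tangent v v) ∧
      (∀ u, F (extChartAt I.tangent v v) (F (extChartAt I.tangent v v) u) = u) ∧
      ∀ u w, flatNijenhuis F (extChartAt I.tangent v v) u w = 0 := by
  obtain ⟨U, hU, hflat⟩ := h.exists_isFlatNormalParacontact v.proj
  refine ⟨_, ?_, contDiffAt_flatProductLift (p := extChartAt I.tangent v v)
    (hflat.smooth_phi _ hU) (hflat.smooth_eta _ hU) (hflat.smooth_xi _ hU),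
    hflat.flatProductLift_flatProductLift (p := extChartAt I.tangent v v) hU,
    hflat.flatNijenhuis_flatProductLift hU _⟩
  filter_upwards [continuous_proj_tangentBundle.continuousAt
    ((chartAt H v.proj).open_source.mem_nhds (mem_chart_source H v.proj))] with w hw
  exact endoFieldRep_completeLiftMetallic h.paracontact.smooth_phi h.paracontact.smooth_eta
    h.paracontact.smooth_xi p q hw

theorem isMetallicStructure (h : IsPSasakian I nabla φ η ξ) {p q : ℕ} (hp : 0 < p) (hq : 0 < q) :
    IsMetallicStructure I.tangent p q (completeLiftMetallic I p q φ η ξ) := by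
  refine ⟨hp, hq, fun v => ?_, fun v u => ?_⟩
  · obtain ⟨F, hF, hs, -, -⟩ := h.exists_flatProductStructure p q v
    refine (contMDiffAt_endoFieldRep_iff (mem_chart_source _ v)).2 ?_
    refine ContMDiffAt.congr_of_eventuallyEq ?_ hF
    have hc : ContDiffAt ℝ ∞ (fun z => ((p : ℝ) / 2) • ContinuousLinearMap.id ℝ (E × E)
        - ((2 * metallicMean p q - p) / 2) • F z) (extChartAt I.tangent v v) :=
      contDiffAt_const.sub (hs.const_smul _)
    exact hc.contMDiffAt.comp v contMDiffAt_extChartAt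
  · obtain ⟨F, hF, -, hFF, -⟩ := h.exists_flatProductStructure p q v
    have h0 := hF.self_of_nhds
    rw [endoFieldRep_self] at h0
    have h1 : ∀ w : E × E, completeLiftMetallic I p q φ η ξ v w = ((p : ℝ) / 2) • w
        - ((2 * metallicMean p q - p) / 2) • F (extChartAt I.tangent v v) w := fun w =>
      congrArg (fun L : (E × E) →L[ℝ] E × E => L w) h0
    have h2 : ∀ w : E × E, ((p : ℝ) / 2) • (((p : ℝ) / 2) • w
        - ((2 * metallicMean p q - p) / 2) • F (extChartAt I.tangent v v) w)
        - ((2 * metallicMean p q - p) / 2) • F (extChartAt I.tangent v v) (((p : ℝ) / 2) • w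
        - ((2 * metallicMean p q - p) / 2) • F (extChartAt I.tangent v v) w)
        = (p : ℝ) • (((p : ℝ) / 2) • w
        - ((2 * metallicMean p q - p) / 2) • F (extChartAt I.tangent v v) w) + (q : ℝ) • w := by
      intro w
      rw [map_sub, map_smul, map_smul, hFF]
      -- After F² = I the terms linear in F agree on both sides, and the multiples of w differ by s²
      -- - (p²/4 + q).
      linear_combination (norm := module) (sq_metallicMean_sub p q) • w
    refine (congrArg _ (h1 u)).trans ((h1 _).trans ((h2 u).trans ?_))
    exact congrArg (fun z : TangentSpace I.tangent v => (p : ℝ) • z + (q : ℝ) • u) (h1 u).symm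

theorem isIntegrableEndoField (h : IsPSasakian I nabla φ η ξ) {p q : ℕ} (hp : 0 < p)
    (hq : 0 < q) :
    IsIntegrableEndoField I.tangent (completeLiftMetallic I p q φ η ξ) := by
  intro X Y hX hY v
  have : CompleteSpace E := FiniteDimensional.complete ℝ E
  have hJ := (h.isMetallicStructure hp hq).smooth v
  obtain ⟨F, hF, hs, -, hN⟩ := h.exists_flatProductStructure p q v
  have hv := mem_chart_source (ModelProd H E) v
  -- In the preferred chart at v the trivialization at v is the identity, so the chart expression is
  -- the Nijenhuis tensor at v itself.
  have hn := continuousLinearMapAt_nijenhuis hv ((contMDiffAt_endoFieldRep_iff hv).1 hJ)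
    ((contMDiffAt_vectorFieldRep_iff hv).1 (hX v)) ((contMDiffAt_vectorFieldRep_iff hv).1 (hY v))
  have he : endoFieldRep I.tangent (completeLiftMetallic I p q φ η ξ) v ∘
      (extChartAt I.tangent v).symm =ᶠ[nhds (extChartAt I.tangent v v)] fun z =>
        ((p : ℝ) / 2) • ContinuousLinearMap.id ℝ (E × E)
          - ((2 * metallicMean p q - p) / 2) • F z := by
    have hc : Filter.Tendsto (extChartAt I.tangent v).symm (nhds (extChartAt I.tangent v v))
        (nhds v) := by
      have := (continuousAt_extChartAt_symm (I := I.tangent) v).tendsto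
      rwa [extChartAt_to_inv] at this
    filter_upwards [hc.eventually hF, extChartAt_target_mem_nhds (I := I.tangent) v] with z hz hz'
    rw [Function.comp_apply, hz, (extChartAt I.tangent v).right_inv hz']
  rw [he.flatNijenhuis_eq, flatNijenhuis_smul_id_sub_smul (hs.differentiableAt (by simp)), hN,
    smul_zero, trivializationAt_clmAt_self] at hn
  exact hn

end IsPSasakian

end ProductLift

end

theorem mainTheorem2 {E : Type*} [NormedAddCommGroup E] [NormedSpace ℝ E] [FiniteDimensional ℝ E]
    {M : Type*} [TopologicalSpace M] [T2Space M] [ChartedSpace E M] [IsManifold 𝓘(ℝ, E) ∞ M]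
    [RiemannianBundle (fun x : M => TangentSpace 𝓘(ℝ, E) x)]
    [IsContMDiffRiemannianBundle 𝓘(ℝ, E) ∞ E (fun x : M => TangentSpace 𝓘(ℝ, E) x)]
    (nabla : CovariantDerivative 𝓘(ℝ, E) E (fun x : M => TangentSpace 𝓘(ℝ, E) x))
    (φ : ∀ x : M, TangentSpace 𝓘(ℝ, E) x →L[ℝ] TangentSpace 𝓘(ℝ, E) x)
    (η : ∀ x : M, TangentSpace 𝓘(ℝ, E) x →L[ℝ] ℝ) (ξ : ∀ x : M, TangentSpace 𝓘(ℝ, E) x)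
    (h : IsPSasakian 𝓘(ℝ, E) nabla φ η ξ) (p q : ℕ) (hp : 0 < p) (hq : 0 < q) :
    IsMetallicStructure 𝓘(ℝ, E).tangent p q (completeLiftMetallic 𝓘(ℝ, E) p q φ η ξ) ∧
      IsIntegrableEndoField 𝓘(ℝ, E).tangent (completeLiftMetallic 𝓘(ℝ, E) p q φ η ξ) :=
  ⟨h.isMetallicStructure hp hq, h.isIntegrableEndoField hp hq⟩
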